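/- **Definitions.** A signed hypergraph $H=(V,S)$ consists of a finite set $V$ of nodes and a finite set $S$ of pairwise distinct signed edges; a signed edge $s=(e,\eta_s)$ is a set $e\subseteq V$ with $|e|\ge 2$ together with a map $\eta_s:e\to\{-1,+1\}$. The underlying hypergraph of $H$ is $G=(V,E)$, where $E$ is the set of all $e$ with $(e,\eta_s)\in S$ for some $\eta_s$; the rank of $H$ is $r=\max_{e\in E}|e|$. The pseudo-Boolean polytope $\mathrm{PBP}(H)\subseteq\mathbb R^{V\cup S}$ is the convex hull of all $z\in\{0,1\}^{V\cup S}$ such that $z_s=\prod_{v\in e}\sigma_s(z_v)$ for every $s=(e,\eta_s)\in S$, where $\sigma_s(z_v)=z_v$ if $\eta_s(v)=+1$ and $\sigma_s(z_v)=1-z_v$ if $\eta_s(v)=-1$. An extended formulation of $\mathrm{PBP}(H)$ is a finite system of linear inequalities in variables $(z,y)$ whose solution set projects onto $\mathrm{PBP}(H)$ in the $z$-space; both the variables $z$ and the variables $y$ are counted. A $\beta$-cycle of length $q\ge3$ in $G$ is a sequence $C=v_1,e_1,v_2,e_2,\dots,v_q,e_q,v_1$ with distinct nodes $v_i$ and distinct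 edges $e_i\in E$ such that $v_i$ belongs to $e_{i-1}$ and $e_i$ and to no other edge among $e_1,\dots,e_q$, for all $i$ (where $e_0:=e_q$). Its support hypergraph is $G[C]=(V[C],E[C])$ with $V[C]=\bigcup_i e_i$ and $E[C]=\{e_1,\dots,e_q\}$. For a nonempty set $E'$ of edges, $\mathrm{gap}(E')=\max_{e\in E'}\big(\big|\bigcup_{f\in E'}f\big|-|e|\big)$, and $\mathrm{gap}(\emptyset)=0$. A hypergraph is connected if any two of its nodes are joined by a sequence of nodes in which consecutive nodes lie in a common edge; the connected components of a hypergraph are its maximal connected partial hypergraphs. **Proposition.** Let $H=(V,S)$ be a signed hypergraph of rank $r$ with $S\ne\emptyset$ and underlying hypergraph $G$. Let $\mathcal C$ be the set of all $\beta$-cycles of $G$, let $\tilde G=\big(\bigcup_{C\in\mathcal C}V[C],\bigcup_{C\in\mathcal C}E[C]\big)$, let $(V_1,E_1),\dots,(V_\omega,E_\omega)$ be the connected components of $\tilde G$, and let $k$ be a nonnegative integer with $\mathrm{gap}(E_i)\le k$ for all $i$. Then $\mathrm{PBP}(H)$ has an extended formulation with $O(r\,2^k\,|V|\,|S|)$ variables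 and inequalities (with an absolute constant in the $O$) in which all coefficients and right-hand side constants are $0,\pm1$. In particular, if $k=O(\log \mathrm{poly}(|V|,|S|))$, then $\mathrm{PBP}(H)$ has a polynomial-size extended formulation with all coefficients and right-hand side constants $0,\pm1$: for every real $a$ and every polynomial $p$ with nonnegative integer coefficients there is a polynomial $q$ such that, for all $H$ and $k$ as above with $k\le a\log p(|V|,|S|)$, there is one with at most $q(|V|,|S|)$ variables and at most $q(|V|,|S|)$ inequalities. -/

import Mathlib

open scoped Hypergraph

noncomputable section

/-! ### Hypergraphs -/

namespace Hypergraph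

variable {V : Type*}

/-- The rank: the maximum cardinality of an edge (used for finite hypergraphs only). -/
def rank (G : Hypergraph V) : ℕ :=
  sSup (Set.ncard '' E(G))

/-- `G'` is a partial hypergraph of `G`. -/
def IsPartial (G' G : Hypergraph V) : Prop :=
  V(G') ⊆ V(G) ∧ E(G') ⊆ E(G)

/-- Any two nodes are joined by a finite sequence of nodes in which consecutive nodes lie in
a common edge. -/
def IsConnected (G : Hypergraph V) : Prop :=
  ∀ u ∈ V(G), ∀ w ∈ V(G), Relation.ReflTransGen G.Adj u w

/-- Connected components are the maximal connected partial hypergraphs. -/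
def IsComponent (K G : Hypergraph V) : Prop :=
  (K.IsPartial G ∧ K.IsConnected) ∧
    ∀ K' : Hypergraph V, K'.IsPartial G → K'.IsConnected → K.IsPartial K' → K' = K

/-- A β-cycle `v₁, e₁, v₂, e₂, …, v_q, e_q, v₁` of length `q ≥ 3`: distinct nodes, distinct edges,
and `v i` lies in `e (i-1)`, `e i` (indices cyclic) and in no other edge of the cycle. -/
structure BetaCycle (G : Hypergraph V) where
  length : ℕ
  three_le : 3 ≤ length
  node : Fin length → V
  edge : Fin length → Set V
  node_injective : Function.Injective node
  edge_injective : Function.Injective edge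
  edge_mem : ∀ i, edge i ∈ E(G)
  node_mem_edge_iff : ∀ i j, node i ∈ edge j ↔ (j = i ∨ finRotate length j = i)

/-- The support hypergraph of a β-cycle. -/
def BetaCycle.support {G : Hypergraph V} (C : G.BetaCycle) : Hypergraph V where
  vertexSet := ⋃ i, C.edge i
  edgeSet := Set.range C.edge
  subset_vertexSet_of_mem_edgeSet' := by
    rintro _ ⟨i, rfl⟩
    exact Set.subset_iUnion C.edge i

/-- The union of the support hypergraphs of all β-cycles of `G`. -/
def betaUnion (G : Hypergraph V) : Hypergraph V where
  vertexSet := ⋃ C : G.BetaCycle, V(C.support)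
  edgeSet := ⋃ C : G.BetaCycle, E(C.support)
  subset_vertexSet_of_mem_edgeSet' := by
    intro e he
    obtain ⟨C, hC⟩ := Set.mem_iUnion.1 he
    exact (C.support.subset_vertexSet_of_mem_edgeSet' hC).trans
      (Set.subset_iUnion (fun C : G.BetaCycle => V(C.support)) C)

/-- The gap of a set of edges: the maximum over its members `e` of `|⋃ E'| - |e|`
(used for finite node types only, where the truncated subtraction is exact). -/
def gap (E' : Set (Set V)) : ℕ :=
  sSup ((fun e : Set V => (⋃₀ E').ncard - e.ncard) '' E')

end Hypergraph

/-! ### Signed hypergraphs and the pseudo-Boolean polytope -/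

/-- A signed edge: a set of at least two nodes, with a sign `±1` on each of its nodes. -/
structure SignedEdge (V : Type*) where
  nodes : Finset V
  two_le_card : 2 ≤ nodes.card
  sign : nodes → ℤˣ

/-- A signed hypergraph with node set `V`; parallel edges are allowed, identical ones are not. -/
structure SignedHypergraph (V : Type*) where
  edges : Finset (SignedEdge V)

namespace SignedHypergraph

variable {V : Type*}

/-- The underlying hypergraph. -/
def underlying (H : SignedHypergraph V) : Hypergraph V where
  vertexSet := Set.univ
  edgeSet := {e | ∃ s ∈ H.edges, (s.nodes : Set V) = e}
  subset_vertexSet_of_mem_edgeSet' := fun _ _ => Set.subset_univ _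

/-- The rank of a signed hypergraph: the maximum cardinality of an edge. -/
def rank (H : SignedHypergraph V) : ℕ := H.underlying.rank

/-- Coordinates of the ambient space `ℝ^(V ∪ S)`. -/
abbrev Coord (H : SignedHypergraph V) : Type _ := V ⊕ {s : SignedEdge V // s ∈ H.edges}

/-- The literal `z_v` for sign `+1`, `1 - z_v` for sign `-1`. -/
def literal (ε : ℤˣ) (t : ℝ) : ℝ := if ε = 1 then t else 1 - t

/-- The pseudo-Boolean set. -/
def PBS (H : SignedHypergraph V) : Set (H.Coord → ℝ) :=
  {z | (∀ i, z i = 0 ∨ z i = 1) ∧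
    ∀ s : {s : SignedEdge V // s ∈ H.edges},
      z (Sum.inr s) = ∏ v : s.1.nodes, literal (s.1.sign v) (z (Sum.inl v.1))}

/-- The pseudo-Boolean polytope. -/
def PBP (H : SignedHypergraph V) : Set (H.Coord → ℝ) := convexHull ℝ H.PBS

end SignedHypergraph

/-! ### Extended formulations -/

/-- `P ⊆ ℝ^I` is the projection to the `x`-variables of a system `A x + B y ≤ b` in which all
coefficients and right-hand sides are `0, ±1`, with at most `N` variables in total (the original
variables `x` and the additional variables `y`) and at most `N` inequalities. Equations count as
two inequalities each. -/
def HasUnitExtendedFormulation {I : Type*} [Fintype I] (P : Set (I → ℝ)) (N : ℕ) : Prop :=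
  ∃ (n m : ℕ) (A : Matrix (Fin m) I ℝ) (B : Matrix (Fin m) (Fin n) ℝ) (b : Fin m → ℝ),
    (∀ i j, A i j ∈ ({-1, 0, 1} : Set ℝ)) ∧
    (∀ i j, B i j ∈ ({-1, 0, 1} : Set ℝ)) ∧
    (∀ i, b i ∈ ({-1, 0, 1} : Set ℝ)) ∧
    Fintype.card I + n ≤ N ∧ m ≤ N ∧
    P = {x | ∃ y : Fin n → ℝ, A.mulVec x + B.mulVec y ≤ b}

end

/-!
The polytope is described by the probabilities that a random 0-1 assignment of the nodes gives to
certain *cubes*, that is, sets of assignments in which the values of some nodes are fixed. The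
nodes are eliminated one at a time, and the linear inequalities say how a distribution of the values
of the remaining nodes extends to the eliminated node.

*Elimination when the edges are nested.* Let the edges through a node `c` form a chain. The cubes
that they leave on the other nodes then form a laminar family. Given a distribution on the other
nodes, the value of `c` can be drawn with a probability that depends only on the smallest cube of
the family that contains the point. The condition for this to produce prescribed probabilities of
the cubes on the edges through `c` is that each half (`c = 0` or `c = 1`) of a cube of the family
has at least the mass of the corresponding halves of its children: a linear system with coefficients
`0, ±1` (`Cube.exists_isProb_extend`).

*Reaching nested edges.* In general an edge `e` through `c` is first inflated: it is replaced by the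
union of all edges through `c` that are not larger than it, and each cube on `e` is split into the
cubes on the larger set. What has to be bounded is the growth of the edges. Give two edges the same
label if they lie in the same component of the union of the β-cycles, so that every β-cycle is
monochromatic. Then the following holds.

* Some node `c` has the property that any two edges of different labels through `c` are nested
  (`exists_node_comparable`). Indeed, in a doubly lexical order of the incidence matrix the two rows
  of every Γ lie on a common β-cycle (`exists_isCyc_of_gamma`), so the first column will do. Hence
  inflating at `c` enlarges an edge only within the union of the edges with its label.
* Inflating at such a node `c` and deleting `c` leaves all β-cycles monochromatic
  (`CyclesMono.inflate_erase`).

So this can be repeated until no node is left (`Cube.exists_encodes`), and at all times an edge `e`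
has grown at most to the node set of its component, by at most `k` nodes. A signed edge therefore
gives rise to at most `2 ^ k` cubes at each of the `|V|` stages, and the system has
`O(2 ^ k |V| |S|)` rows and variables.
-/

noncomputable section

/-! ### Doubly lexical orders of a 0-1 matrix -/

section DoublyLexical

variable {R C : Type*}

/-- The rows of the 0-1 matrix `inc` are sorted by `τ` in the lexicographic order in which the
columns with the largest `σ` are the most significant: where an earlier row has a `1` and a later
row a `0`, the last column that separates the two rows comes later still, and it has a `0` in the
earlier and a `1` in the later row. -/
def RowsLexSorted (inc : R → C → Prop) (σ : C → ℕ) (τ : R → ℕ) : Prop :=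
  ∀ r s c, τ r < τ s → inc r c → ¬ inc s c →
    ∃ c', σ c < σ c' ∧ inc s c' ∧ ¬ inc r c' ∧ ∀ d, σ c' < σ d → (inc r d ↔ inc s d)

/-- The exchange argument of the rearrangement inequality: an order that maximizes the sum with
weights `2 ^ τ r` is sorted by `A`. -/
theorem le_of_sum_two_pow_maximal [Fintype R] {n : ℕ} (A : R → ℕ) (τ : R ≃ Fin n)
    (hmax : ∀ τ' : R ≃ Fin n,
      ∑ r, 2 ^ (τ' r : ℕ) * A r ≤ ∑ r, 2 ^ (τ r : ℕ) * A r)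
    {r s : R} (hrs : τ r < τ s) : A r ≤ A s := by
  classical
  have hne : r ≠ s := by rintro rfl; exact lt_irrefl _ hrs
  have h := hmax ((Equiv.swap r s).trans τ)
  have key : ∀ f : R → ℕ, ∑ x, f x = f r + f s + ∑ x ∈ (Finset.univ.erase r).erase s, f x := by
    intro f
    rw [← Finset.add_sum_erase _ f (Finset.mem_univ r),
      ← Finset.add_sum_erase (Finset.univ.erase r) f (a := s) (by simp [hne.symm]), add_assoc]
  rw [key, key (fun r => 2 ^ (τ r : ℕ) * A r)] at h
  have hrest : ∑ x ∈ (Finset.univ.erase r).erase s, 2 ^ (((Equiv.swap r s).trans τ) x : ℕ) * A x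
      = ∑ x ∈ (Finset.univ.erase r).erase s, 2 ^ (τ x : ℕ) * A x := by
    refine Finset.sum_congr rfl fun x hx => ?_
    simp only [Finset.mem_erase] at hx
    simp [Equiv.swap_apply_of_ne_of_ne hx.2.1 hx.1]
  rw [hrest] at h
  simp only [Equiv.trans_apply, Equiv.swap_apply_left, Equiv.swap_apply_right] at h
  have hpow : 2 ^ (τ r : ℕ) < 2 ^ (τ s : ℕ) := Nat.pow_lt_pow_right (by norm_num) hrs
  by_contra hlt
  push Not at hlt
  nlinarith

/-- Sorting the rows by the numbers that they represent in base 2 is sorting them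
lexicographically. -/
theorem rowsLexSorted_of_sum_two_pow_le [Fintype C] (inc : R → C → Prop)
    [∀ r c, Decidable (inc r c)] (σ : C → ℕ) (hσ : Function.Injective σ) (τ : R → ℕ)
    (h : ∀ r s, τ r < τ s →
      ∑ c with inc r c, 2 ^ σ c ≤ ∑ c with inc s c, 2 ^ σ c) :
    RowsLexSorted inc σ τ := by
  classical
  intro r s c hrs hr hs
  have himg : ∀ t, ∑ c with inc t c, 2 ^ σ c
      = ∑ k ∈ (Finset.univ.filter (inc t)).image σ, 2 ^ k := fun t =>
    (Finset.sum_image (fun _ _ _ _ h => hσ h)).symm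
  have hle := h r s hrs
  rw [himg, himg, Finset.geomSum_le_geomSum_iff_toColex_le_toColex le_rfl] at hle
  have hmem : ∀ t d, σ d ∈ (Finset.univ.filter (inc t)).image σ ↔ inc t d := by
    intro t d
    simp [hσ.eq_iff]
  have hlt := lt_of_le_of_ne hle (by
    intro heq
    have heq' := toColex_inj.1 heq
    have := (hmem r c).2 hr
    rw [heq', hmem] at this
    exact hs this)
  rw [Finset.Colex.lt_iff_exists_filter_lt] at hlt
  obtain ⟨w, hw, hfil⟩ := hlt
  rw [Finset.mem_sdiff] at hw
  obtain ⟨c', -, rfl⟩ := Finset.mem_image.1 hw.1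
  rw [hmem, hmem] at hw
  have hagree : ∀ d, σ c' < σ d → (inc r d ↔ inc s d) := by
    intro d hd
    have := Finset.ext_iff.1 hfil (σ d)
    simpa only [Finset.mem_filter, hmem, hd, and_true] using this
  refine ⟨c', ?_, hw.1, hw.2, hagree⟩
  by_contra hcc
  rcases (not_lt.1 hcc).lt_or_eq with hlt | heq
  · exact hs ((hagree c hlt).1 hr)
  · rw [hσ heq] at hw
    exact hw.2 hr

/-- Every 0-1 matrix has a doubly lexical order. Among all orders of the rows and of the columns,
one that maximizes `∑ 2 ^ (τ r + σ c)` over the `1` entries is doubly lexical. -/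
theorem exists_doublyLexical [Fintype R] [Fintype C] (inc : R → C → Prop) :
    ∃ (σ : C → ℕ) (τ : R → ℕ), Function.Injective σ ∧ Function.Injective τ ∧
      RowsLexSorted inc σ τ ∧ RowsLexSorted (flip inc) τ σ := by
  classical
  let Φ : (R ≃ Fin (Fintype.card R)) × (C ≃ Fin (Fintype.card C)) → ℕ := fun p =>
    ∑ r, 2 ^ (p.1 r : ℕ) * ∑ c with inc r c, 2 ^ (p.2 c : ℕ)
  have hcomm : ∀ p, Φ p = ∑ c, 2 ^ (p.2 c : ℕ) * ∑ r with inc r c, 2 ^ (p.1 r : ℕ) := by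
    intro p
    simp only [Φ, Finset.sum_filter, Finset.mul_sum]
    rw [Finset.sum_comm]
    refine Finset.sum_congr rfl fun c _ => Finset.sum_congr rfl fun r _ => ?_
    split_ifs <;> ring
  obtain ⟨⟨τ, σ⟩, -, hmax⟩ := Finset.exists_max_image Finset.univ Φ
    ⟨(Fintype.equivFin R, Fintype.equivFin C), Finset.mem_univ _⟩
  refine ⟨fun c => σ c, fun r => τ r, fun a b h => σ.injective (Fin.ext h),
    fun a b h => τ.injective (Fin.ext h), ?_, ?_⟩
  · refine rowsLexSorted_of_sum_two_pow_le inc _ (fun a b h => σ.injective (Fin.ext h)) _ ?_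
    intro r s hrs
    exact le_of_sum_two_pow_maximal (fun r => ∑ c with inc r c, 2 ^ (σ c : ℕ)) τ
      (fun τ' => hmax (τ', σ) (Finset.mem_univ _)) hrs
  · refine rowsLexSorted_of_sum_two_pow_le (flip inc) _ (fun a b h => τ.injective (Fin.ext h)) _ ?_
    intro c d hcd
    refine le_of_sum_two_pow_maximal (fun c => ∑ r with inc r c, 2 ^ (τ r : ℕ)) σ
      (fun σ' => ?_) hcd
    have := hmax (τ, σ') (Finset.mem_univ _)
    rwa [hcomm, hcomm] at this

end DoublyLexical

/-! ### Cycles through a Γ of a doubly lexical order -/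

/-- A β-cycle in an indexed family of node sets: for `i, j < q`, the node `v i` lies in the set with
index `e j` if and only if `j` is `i` or the cyclic predecessor of `i`. The values of `v` and `e`
from `q` on play no role, and distinctness of nodes and sets is automatic for `3 ≤ q`. -/
structure IsCyc {ι V : Type*} (E : ι → Finset V) (q : ℕ) (v : ℕ → V) (e : ℕ → ι) : Prop where
  three_le : 3 ≤ q
  mem_iff : ∀ i < q, ∀ j < q, v i ∈ E (e j) ↔ (j = i ∨ j + 1 = i ∨ (j + 1 = q ∧ i = 0))

section Zigzag

variable {R C : Type*} {inc : R → C → Prop} {σ : C → ℕ} {τ : R → ℕ}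

/-- A Γ of a doubly lexical order extends to a zigzag path of rows and columns that closes up: at
each stage, the lexicographic comparison of the last two rows gives the next column, and that of
the last two columns the next row. In the path, the row `r i` meets the column `c j` exactly for
`|i - j| = 1` and for `i = j = 1`, and beyond its end all rows but the last agree on the remaining
columns, and all columns but the last on the remaining rows. Indices start at `1`. -/
theorem exists_closed_zigzag (hrow : RowsLexSorted inc σ τ) (hcol : RowsLexSorted (flip inc) τ σ)
    (B : ℕ) (hB : ∀ c, σ c ≤ B) (m : ℕ) : ∀ (n : ℕ) (r : ℕ → R) (c : ℕ → C), 2 ≤ n →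
    B < σ (c n) + m →
    (∀ i j, 1 ≤ i → i ≤ n → 1 ≤ j → j ≤ n →
      (inc (r i) (c j) ↔ (i + 1 = j ∨ j + 1 = i ∨ (i = 1 ∧ j = 1)))) →
    τ (r (n - 1)) < τ (r n) → σ (c (n - 1)) < σ (c n) →
    (∀ i, 1 ≤ i → i < n → ∀ d, σ (c n) < σ d → (inc (r i) d ↔ inc (r (n - 1)) d)) →
    (∀ j, 1 ≤ j → j < n → ∀ s, τ (r n) < τ s → (inc s (c j) ↔ inc s (c (n - 1)))) →
    ∃ (N : ℕ) (r' : ℕ → R) (c' : ℕ → C), 3 ≤ N ∧ r' 1 = r 1 ∧ r' 2 = r 2 ∧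
      ∀ i j, 1 ≤ i → i ≤ N → 1 ≤ j → j ≤ N →
        (inc (r' i) (c' j) ↔ (i + 1 = j ∨ j + 1 = i ∨ (i = 1 ∧ j = 1) ∨ (i = N ∧ j = N))) := by
  induction m with
  | zero =>
    intro n r c _ hm
    exact absurd (hB (c n)) (by omega)
  | succ m ih =>
    intro n r c hn hm hinc hr hc hra hca
    have h1 : inc (r (n - 1)) (c n) :=
      (hinc _ _ (by omega) (by omega) (by omega) le_rfl).2 (by omega)
    have h2 : inc (r n) (c (n - 1)) :=
      (hinc _ _ (by omega) le_rfl (by omega) (by omega)).2 (by omega)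
    have h3 : ¬ inc (r n) (c n) := fun h => by
      have := (hinc _ _ (by omega) le_rfl (by omega) le_rfl).1 h
      omega
    obtain ⟨c₀, hc₀, hc1, hc2, hc3⟩ := hrow _ _ _ hr h1 h3
    obtain ⟨r₀, hr₀, hr1, hr2, hr3⟩ := hcol _ _ _ hc h2 h3
    have hcol₀ : ∀ i, 1 ≤ i → i ≤ n → (inc (r i) c₀ ↔ i = n) := by
      intro i hi hin
      rcases hin.lt_or_eq with hlt | rfl
      · rw [hra i hi hlt c₀ hc₀]
        exact iff_of_false hc2 hlt.ne
      · exact iff_of_true hc1 rfl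
    have hrow₀ : ∀ j, 1 ≤ j → j ≤ n → (inc r₀ (c j) ↔ j = n) := by
      intro j hj hjn
      rcases hjn.lt_or_eq with hlt | rfl
      · rw [hca j hj hlt r₀ hr₀]
        exact iff_of_false hr2 hlt.ne
      · exact iff_of_true hr1 rfl
    let r' := Function.update r (n + 1) r₀
    let c' := Function.update c (n + 1) c₀
    have hr'n : r' (n + 1) = r₀ := by simp [r']
    have hc'n : c' (n + 1) = c₀ := by simp [c']
    have hr' : ∀ i, i ≤ n → r' i = r i := fun i hi =>
      Function.update_of_ne (by omega) _ _
    have hc' : ∀ i, i ≤ n → c' i = c i := fun i hi =>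
      Function.update_of_ne (by omega) _ _
    have hpat : ∀ i j, 1 ≤ i → i ≤ n + 1 → 1 ≤ j → j ≤ n + 1 → (i ≠ n + 1 ∨ j ≠ n + 1) →
        (inc (r' i) (c' j) ↔ (i + 1 = j ∨ j + 1 = i ∨ (i = 1 ∧ j = 1))) := by
      intro i j hi hin hj hjn hij
      by_cases hi' : i = n + 1
      · subst hi'
        have hjn' : j ≤ n := by omega
        rw [hr'n, hc' j hjn', hrow₀ j hj hjn']
        omega
      · have hin' : i ≤ n := by omega
        rw [hr' i hin']
        by_cases hj' : j = n + 1
        · subst hj'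
          rw [hc'n, hcol₀ i hi hin']
          omega
        · have hjn' : j ≤ n := by omega
          rw [hc' j hjn', hinc i j hi hin' hj hjn']
    by_cases hclose : inc r₀ c₀
    · refine ⟨n + 1, r', c', by omega, hr' 1 (by omega), hr' 2 hn, ?_⟩
      intro i j hi hin hj hjn
      by_cases hij : i = n + 1 ∧ j = n + 1
      · obtain ⟨rfl, rfl⟩ := hij
        rw [hr'n, hc'n]
        exact iff_of_true hclose (by omega)
      · rw [hpat i j hi hin hj hjn (by omega)]
        omega
    · obtain ⟨N, r'', c'', hN, h1', h2', hfin⟩ := ih (n + 1) r' c' (by omega)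
        (by rw [hc'n]; omega)
        (by
          intro i j hi hin hj hjn
          by_cases hij : i = n + 1 ∧ j = n + 1
          · obtain ⟨rfl, rfl⟩ := hij
            rw [hr'n, hc'n]
            exact iff_of_false hclose (by omega)
          · exact hpat i j hi hin hj hjn (by omega))
        (by rw [Nat.add_sub_cancel, hr' n le_rfl, hr'n]; exact hr₀)
        (by rw [Nat.add_sub_cancel, hc' n le_rfl, hc'n]; exact hc₀)
        (by
          intro i hi hin d hd
          rw [hc'n] at hd
          rw [Nat.add_sub_cancel, hr' n le_rfl, hr' i (by omega)]
          by_cases hi' : i = n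
          · rw [hi']
          · rw [hra i hi (by omega) d (hc₀.trans hd), hc3 d hd])
        (by
          intro j hj hjn s hs
          rw [hr'n] at hs
          rw [Nat.add_sub_cancel, hc' n le_rfl, hc' j (by omega)]
          by_cases hj' : j = n
          · rw [hj']
          · rw [hca j hj (by omega) s (hr₀.trans hs)]
            exact hr3 s hs)
      exact ⟨N, r'', c'', hN, h1'.trans (hr' 1 (by omega)), h2'.trans (hr' 2 hn), hfin⟩

end Zigzag

variable {ι V : Type*}

/-- In a doubly lexical order, the two rows of a Γ lie on a common β-cycle. The rows of the closed
zigzag path are visited in the order `1, 3, 5, …, 6, 4, 2`. -/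
theorem exists_isCyc_of_gamma [Fintype V] {E : ι → Finset V} {σ : V → ℕ} {τ : ι → ℕ}
    (hrow : RowsLexSorted (fun s v => v ∈ E s) σ τ)
    (hcol : RowsLexSorted (flip fun s v => v ∈ E s) τ σ)
    {r s : ι} {c d : V} (hrs : τ r < τ s) (hcd : σ c < σ d)
    (hrc : c ∈ E r) (hrd : d ∈ E r) (hsc : c ∈ E s) (hsd : d ∉ E s) :
    ∃ q v e, IsCyc E q v e ∧ ∃ i < q, ∃ j < q, e i = r ∧ e j = s := by
  obtain ⟨N, r', c', hN, hr1, hr2, hpat⟩ := exists_closed_zigzag hrow hcol (Finset.univ.sup σ)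
    (fun c => Finset.le_sup (Finset.mem_univ c)) (Finset.univ.sup σ + 1) 2
    (fun i => if i = 1 then r else s) (fun j => if j = 1 then c else d) le_rfl
    (by rw [if_neg (by omega)]; omega)
    (by
      intro i j hi hi2 hj hj2
      interval_cases i <;> interval_cases j <;> simp [hrc, hrd, hsc, hsd])
    (by simpa using hrs) (by simpa using hcd)
    (by
      intro i hi hi2 d _
      obtain rfl : i = 1 := by omega
      simp)
    (by
      intro i hi hi2 d _
      obtain rfl : i = 1 := by omega
      simp)
  refine ⟨N, fun t => c' (if t = 0 then 1 else if 2 * t ≤ N then 2 * t else 2 * (N - t) + 1),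
    fun t => r' (if 2 * t + 1 ≤ N then 2 * t + 1 else 2 * (N - t)), ⟨hN, ?_⟩, 0, by omega, N - 1,
    by omega, ?_, ?_⟩
  · intro i hi j hj
    refine (hpat _ _ ?_ ?_ ?_ ?_).trans ?_ <;> split_ifs <;> omega
  · have : 2 * 0 + 1 ≤ N := by omega
    simp only [this, if_true]
    simpa using hr1
  · have h : ¬ 2 * (N - 1) + 1 ≤ N := by omega
    have h' : 2 * (N - (N - 1)) = 2 := by omega
    simp only [h, if_false, h']
    simpa using hr2

/-! ### Elimination of a node from a labelled family of sets -/

section Elimination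

variable {ι V : Type*}

/-- Every β-cycle of the family `E` stays within one class of the labelling `lab`. -/
def CyclesMono {L : Type*} (E : ι → Finset V) (lab : ι → L) : Prop :=
  ∀ q v e, IsCyc E q v e → ∀ i < q, ∀ j < q, lab (e i) = lab (e j)

theorem IsCyc.rotate {E : ι → Finset V} {q : ℕ} {v : ℕ → V} {e : ℕ → ι} (h : IsCyc E q v e)
    (t : ℕ) (ht : t < q) :
    IsCyc E q (fun i => v (if i + t < q then i + t else i + t - q))
      (fun j => e (if j + t < q then j + t else j + t - q)) := by
  have h3 := h.three_le
  refine ⟨h3, fun i hi j hj => ?_⟩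
  refine (h.mem_iff _ ?_ _ ?_).trans ?_ <;> split_ifs <;> omega

/-- If all β-cycles are monochromatic, then some node `c` has the property that any two sets of
different labels through `c` are comparable: the first column of a doubly lexical order, since two
incomparable sets through it form a Γ. -/
theorem exists_node_comparable [Finite ι] [Finite V] {L : Type*} {E : ι → Finset V} {lab : ι → L}
    (hmono : CyclesMono E lab) {U : Finset V} (hU : U.Nonempty) (hEU : ∀ s, E s ⊆ U) :
    ∃ c ∈ U, ∀ s t, c ∈ E s → c ∈ E t → lab s ≠ lab t → E s ⊆ E t ∨ E t ⊆ E s := by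
  have := Fintype.ofFinite ι
  have := Fintype.ofFinite V
  obtain ⟨σ, τ, hσ, hτ, hrow, hcol⟩ := exists_doublyLexical (fun (s : ι) v => v ∈ E s)
  obtain ⟨c, hc, hmin⟩ := U.exists_min_image σ hU
  have key : ∀ s t, c ∈ E s → c ∈ E t → lab s ≠ lab t → τ s < τ t → E s ⊆ E t := by
    intro s t hs ht hne hlt d hd
    by_contra hdt
    have hcd : σ c < σ d := lt_of_le_of_ne (hmin d (hEU s hd)) (fun h => hdt (hσ h ▸ ht))
    obtain ⟨q, v, e, hcyc, i, hi, j, hj, rfl, rfl⟩ :=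
      exists_isCyc_of_gamma hrow hcol hlt hcd hs hd ht hdt
    exact hne (hmono q v e hcyc i hi j hj)
  refine ⟨c, hc, fun s t hs ht hne => ?_⟩
  rcases lt_trichotomy (τ s) (τ t) with h | h | h
  · exact Or.inl (key s t hs ht hne h)
  · exact absurd (congrArg lab (hτ h)) hne
  · exact Or.inr (key t s ht hs hne.symm h)

open scoped Classical in
/-- The inflation of the family at the node `c`: each set through `c` is enlarged to the union of
all sets through `c` that are not larger than it. The inflated sets through `c` form a chain. -/
def inflate [Fintype ι] (E : ι → Finset V) (c : V) (s : ι) : Finset V :=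
  if c ∈ E s then
    (Finset.univ.filter fun t => c ∈ E t ∧ (E t).card ≤ (E s).card).biUnion E
  else E s

variable [Fintype ι] {E : ι → Finset V} {c : V}

theorem inflate_of_notMem {s : ι} (h : c ∉ E s) : inflate E c s = E s := by simp [inflate, h]

theorem mem_inflate {s : ι} (h : c ∈ E s) {x : V} :
    x ∈ inflate E c s ↔ ∃ t, c ∈ E t ∧ (E t).card ≤ (E s).card ∧ x ∈ E t := by
  simp [inflate, h, and_assoc]

theorem subset_inflate (s : ι) : E s ⊆ inflate E c s := by
  by_cases h : c ∈ E s
  · exact fun x hx => (mem_inflate h).2 ⟨s, h, le_rfl, hx⟩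
  · rw [inflate_of_notMem h]

theorem mem_inflate_self {s : ι} : c ∈ inflate E c s ↔ c ∈ E s := by
  by_cases h : c ∈ E s
  · exact iff_of_true (subset_inflate s h) h
  · rw [inflate_of_notMem h]

theorem inflate_subset_inflate {s t : ι} (hs : c ∈ E s) (ht : c ∈ E t)
    (h : (E s).card ≤ (E t).card) : inflate E c s ⊆ inflate E c t := by
  intro x hx
  obtain ⟨u, hu, hle, hxu⟩ := (mem_inflate hs).1 hx
  exact (mem_inflate ht).2 ⟨u, hu, hle.trans h, hxu⟩

theorem inflate_comparable {s t : ι} (hs : c ∈ E s) (ht : c ∈ E t) :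
    inflate E c s ⊆ inflate E c t ∨ inflate E c t ⊆ inflate E c s :=
  (le_total (E s).card (E t).card).imp (inflate_subset_inflate hs ht) (inflate_subset_inflate ht hs)

theorem inflate_subset {X : Finset V} (hX : ∀ s, E s ⊆ X) (s : ι) : inflate E c s ⊆ X := by
  by_cases h : c ∈ E s
  · intro x hx
    obtain ⟨t, -, -, hxt⟩ := (mem_inflate h).1 hx
    exact hX t hxt
  · rw [inflate_of_notMem h]
    exact hX s

section Comparable

variable {L : Type*} {lab : ι → L}
  (hcomp : ∀ s t, c ∈ E s → c ∈ E t → lab s ≠ lab t → E s ⊆ E t ∨ E t ⊆ E s)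
include hcomp

omit [Fintype ι] in
theorem subset_of_card_le {s t : ι} (hs : c ∈ E s) (ht : c ∈ E t) (hne : lab s ≠ lab t)
    (hle : (E s).card ≤ (E t).card) : E s ⊆ E t := by
  rcases hcomp s t hs ht hne with h | h
  · exact h
  · exact (Finset.eq_of_subset_of_card_le h hle).ge

/-- Inflation enlarges a set within the union of the sets that have the same label. -/
theorem exists_lab_eq_of_mem_inflate {s : ι} {x : V} (hx : x ∈ inflate E c s) :
    ∃ t, lab t = lab s ∧ x ∈ E t := by
  by_cases h : c ∈ E s
  · obtain ⟨t, hct, hle, hxt⟩ := (mem_inflate h).1 hx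
    by_cases hl : lab t = lab s
    · exact ⟨t, hl, hxt⟩
    · exact ⟨s, rfl, subset_of_card_le hcomp hct h hl hle hxt⟩
  · rw [inflate_of_notMem h] at hx
    exact ⟨s, rfl, hx⟩

open scoped Classical in
/-- Inflating at `c` and then deleting `c` keeps all β-cycles monochromatic. A β-cycle of the new
family contains at most one set that was inflated, as these form a chain. If the two nodes of the
cycle in that set lie in a common old set, this set may take its place. Otherwise they lie in two
old sets through `c`, and the cycle can be rerouted through these two sets and `c`. -/
theorem CyclesMono.inflate_erase (hmono : CyclesMono E lab) :
    CyclesMono (fun s => (inflate E c s).erase c) lab := by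
  -- a cycle whose sets, except possibly the last one, avoid `c`
  have last : ∀ q v e, IsCyc (fun s => (inflate E c s).erase c) q v e →
      (∀ j < q, c ∈ E (e j) → j = q - 1) → ∀ i < q, ∀ j < q, lab (e i) = lab (e j) := by
    intro q v e hcyc hlast
    have h3 := hcyc.three_le
    have hvc : ∀ i < q, v i ≠ c := fun i hi =>
      (Finset.mem_erase.1 ((hcyc.mem_iff i hi i hi).2 (Or.inl rfl))).1
    have hinf : ∀ i < q, ∀ j < q, v i ∈ inflate E c (e j) ↔
        (j = i ∨ j + 1 = i ∨ (j + 1 = q ∧ i = 0)) := fun i hi j hj => by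
      rw [← hcyc.mem_iff i hi j hj, Finset.mem_erase]
      simp [hvc i hi]
    have hold : ∀ i < q, ∀ j < q - 1, v i ∈ E (e j) ↔
        (j = i ∨ j + 1 = i ∨ (j + 1 = q ∧ i = 0)) := fun i hi j hj => by
      rw [← hinf i hi j (by omega), inflate_of_notMem]
      exact fun h => by have := hlast j (by omega) h; omega
    set r := e (q - 1) with hr
    -- an old set through the two nodes of the last set may replace it
    have replace : ∀ d, E d ⊆ inflate E c r → v 0 ∈ E d → v (q - 1) ∈ E d →
        IsCyc E q v (Function.update e (q - 1) d) := by
      intro d hd h0 h1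
      refine ⟨h3, fun i hi j hj => ?_⟩
      by_cases hj' : j = q - 1
      · subst hj'
        rw [Function.update_self]
        constructor
        · exact fun h => (hinf i hi (q - 1) hj).1 (hd h)
        · intro h
          obtain rfl | rfl : i = 0 ∨ i = q - 1 := by omega
          · exact h0
          · exact h1
      · rw [Function.update_of_ne hj']
        exact hold i hi j (by omega)
    have replace_mono : ∀ d, lab d = lab r → E d ⊆ inflate E c r → v 0 ∈ E d → v (q - 1) ∈ E d →
        ∀ i < q, ∀ j < q, lab (e i) = lab (e j) := by
      intro d hlab hd h0 h1
      have hl : ∀ i, lab (Function.update e (q - 1) d i) = lab (e i) := by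
        intro i
        by_cases hi : i = q - 1
        · rw [hi, Function.update_self, hlab]
        · rw [Function.update_of_ne hi]
      intro i hi j hj
      rw [← hl i, ← hl j]
      exact hmono q v _ (replace d hd h0 h1) i hi j hj
    have h0 : v 0 ∈ inflate E c r := (hinf 0 (by omega) (q - 1) (by omega)).2 (by omega)
    have h1 : v (q - 1) ∈ inflate E c r := (hinf (q - 1) (by omega) (q - 1) (by omega)).2 (by omega)
    by_cases hcr : c ∈ E r
    swap
    · rw [inflate_of_notMem hcr] at h0 h1
      exact replace_mono r rfl (subset_inflate r) h0 h1
    have hsub : ∀ d, c ∈ E d → (E d).card ≤ (E r).card → E d ⊆ inflate E c r :=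
      fun d hd hle x hx => (mem_inflate hcr).2 ⟨d, hd, hle, hx⟩
    by_cases hex : v 0 ∈ E r ∧ v (q - 1) ∈ E r
    · exact replace_mono r rfl (subset_inflate r) hex.1 hex.2
    obtain ⟨a, hca, hla, h0a⟩ := (mem_inflate hcr).1 h0
    obtain ⟨b, hcb, hlb, h1b⟩ := (mem_inflate hcr).1 h1
    have hlab : ∀ d, c ∈ E d → (E d).card ≤ (E r).card → v 0 ∈ E d → v (q - 1) ∈ E d →
        lab d = lab r := by
      intro d hd hle hd0 hd1
      by_contra hne
      have := subset_of_card_le hcomp hd hcr hne hle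
      exact hex ⟨this hd0, this hd1⟩
    by_cases h1a : v (q - 1) ∈ E a
    · exact replace_mono a (hlab a hca hla h0a h1a) (hsub a hca hla) h0a h1a
    by_cases h0b : v 0 ∈ E b
    · exact replace_mono b (hlab b hcb hlb h0b h1b) (hsub b hcb hlb) h0b h1b
    -- reroute through `b`, `c` and `a`
    let v' := Function.update v q c
    let e' := Function.update (Function.update e (q - 1) b) q a
    have hv'q : v' q = c := by simp [v']
    have hv' : ∀ i < q, v' i = v i := fun i hi => Function.update_of_ne hi.ne _ _
    have he'q : e' q = a := by simp [e']
    have he'q1 : e' (q - 1) = b := by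
      simp only [e']
      rw [Function.update_of_ne (by omega), Function.update_self]
    have he' : ∀ j < q - 1, e' j = e j := fun j hj => by
      simp only [e']
      rw [Function.update_of_ne (by omega), Function.update_of_ne (by omega)]
    have hcyc' : IsCyc E (q + 1) v' e' := by
      refine ⟨by omega, fun i hi j hj => ?_⟩
      by_cases hiq : i = q
      · subst hiq
        rw [hv'q]
        by_cases hjq : j = i
        · rw [hjq, he'q]
          exact iff_of_true hca (by omega)
        by_cases hjq1 : j = i - 1
        · rw [hjq1, he'q1]
          exact iff_of_true hcb (by omega)
        rw [he' j (by omega)]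
        refine iff_of_false (fun h => ?_) (by omega)
        have := hlast j (by omega) h
        omega
      · have hi' : i < q := by omega
        rw [hv' i hi']
        have hmid : ∀ d, E d ⊆ inflate E c r → v i ∈ E d → i = 0 ∨ i = q - 1 := fun d hd h => by
          have := (hinf i hi' (q - 1) (by omega)).1 (hd h)
          omega
        by_cases hjq : j = q
        · rw [hjq, he'q]
          constructor
          · intro h
            rcases hmid a (hsub a hca hla) h with rfl | rfl
            · omega
            · exact absurd h h1a
          · intro h
            obtain rfl : i = 0 := by omega
            exact h0a
        by_cases hjq1 : j = q - 1
        · rw [hjq1, he'q1]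
          constructor
          · intro h
            rcases hmid b (hsub b hcb hlb) h with rfl | rfl
            · exact absurd h h0b
            · omega
          · intro h
            obtain rfl : i = q - 1 := by omega
            exact h1b
        rw [he' j (by omega), hold i hi' j (by omega)]
        omega
    have hm := hmono _ _ _ hcyc'
    have hab : lab b = lab a := by
      have := hm (q - 1) (by omega) q (by omega)
      rwa [he'q, he'q1] at this
    have hra : lab a = lab r := by
      by_contra hne
      exact hex ⟨subset_of_card_le hcomp hca hcr hne hla h0a,
        subset_of_card_le hcomp hcb hcr (hab ▸ hne) hlb h1b⟩
    have hall : ∀ i < q, lab (e i) = lab a := by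
      intro i hi
      by_cases hi' : i = q - 1
      · rw [hi', ← hr, hra]
      · have := hm i (by omega) q (by omega)
        rwa [he'q, he' i (by omega)] at this
    intro i hi j hj
    rw [hall i hi, hall j hj]
  intro q v e hcyc
  have h3 := hcyc.three_le
  -- at most one set of the cycle contains `c`
  have hone : ∀ i < q, ∀ j < q, c ∈ E (e i) → c ∈ E (e j) → i = j := by
    have key : ∀ i < q, ∀ j < q, inflate E c (e i) ⊆ inflate E c (e j) → i = j := by
      intro i hi j hj hsub
      have hs : ∀ x, x ∈ (inflate E c (e i)).erase c → x ∈ (inflate E c (e j)).erase c :=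
        fun x hx => Finset.erase_subset_erase c hsub hx
      have h1 := (hcyc.mem_iff i hi j hj).1 (hs _ ((hcyc.mem_iff i hi i hi).2 (Or.inl rfl)))
      by_cases hiq : i + 1 = q
      · have h2 := (hcyc.mem_iff 0 (by omega) j hj).1
          (hs _ ((hcyc.mem_iff 0 (by omega) i hi).2 (by omega)))
        omega
      · have h2 := (hcyc.mem_iff (i + 1) (by omega) j hj).1
          (hs _ ((hcyc.mem_iff (i + 1) (by omega) i hi).2 (by omega)))
        omega
    intro i hi j hj hci hcj
    rcases inflate_comparable hci hcj with h | h
    · exact key i hi j hj h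
    · exact (key j hj i hi h).symm
  by_cases hex : ∃ t < q, c ∈ E (e t)
  · obtain ⟨t, ht, hct⟩ := hex
    -- rotate the cycle so that this set comes last
    let t' := if t + 1 = q then 0 else t + 1
    have ht' : t' < q := by simp only [t']; split_ifs <;> omega
    have hrot := last q _ _ (hcyc.rotate t' ht') (by
      intro j hj hcj
      have := hone _ (by split_ifs <;> omega) t ht hcj hct
      simp only [t'] at this
      split_ifs at this <;> omega)
    have hback : ∀ i < q, ∃ i' < q, (if i' + t' < q then i' + t' else i' + t' - q) = i := by
      intro i hi
      refine ⟨if t' ≤ i then i - t' else i + q - t', ?_, ?_⟩ <;> split_ifs <;> omega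
    intro i hi j hj
    obtain ⟨i', hi', hi''⟩ := hback i hi
    obtain ⟨j', hj', hj''⟩ := hback j hj
    have := hrot i' hi' j' hj'
    simpa only [hi'', hj''] using this
  · exact last q v e hcyc fun j hj hcj => absurd ⟨j, hj, hcj⟩ hex

end Comparable

end Elimination

/-! ### Cubes and probability distributions on the 0-1 points -/

/-- A partial 0-1 assignment to the nodes, seen as the subcube of all assignments that extend it. -/
def Cube (V : Type*) := V → Option Bool

namespace Cube

variable {V : Type*}

instance [Fintype V] : Fintype (Cube V) := by
  classical exact inferInstanceAs (Fintype (V → Option Bool))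

/-- `A ≤ B` if `B` assigns to each node in the support of `A` the same value as `A`. -/
instance : PartialOrder (Cube V) where
  le A B := ∀ v b, A v = some b → B v = some b
  le_refl _ _ _ h := h
  le_trans _ _ _ h₁ h₂ v b h := h₂ v b (h₁ v b h)
  le_antisymm A B h₁ h₂ := by
    funext v
    cases hA : A v with
    | some b => exact (h₁ v b hA).symm
    | none =>
      cases hB : B v with
      | some b => exact absurd (h₂ v b hB) (by simp [hA])
      | none => rfl

instance : OrderBot (Cube V) where
  bot _ := none
  bot_le _ _ _ h := by cases h

/-- The assignment `x` belongs to the cube `A`. -/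
def Holds (x : V → Bool) (A : Cube V) : Prop := ∀ v b, A v = some b → x v = b

theorem holds_bot (x : V → Bool) : Holds x (⊥ : Cube V) := fun _ _ h => by cases h

theorem Holds.mono {x : V → Bool} {A B : Cube V} (h : Holds x B) (hAB : A ≤ B) : Holds x A :=
  fun v b hb => h v b (hAB v b hb)

open scoped Classical in
/-- The indicator function of membership of `x` in a cube. -/
def ind (x : V → Bool) (A : Cube V) : ℝ := if Holds x A then 1 else 0

theorem ind_of_holds {x : V → Bool} {A : Cube V} (h : Holds x A) : ind x A = 1 := if_pos h

theorem ind_of_not_holds {x : V → Bool} {A : Cube V} (h : ¬ Holds x A) : ind x A = 0 := if_neg h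

/-- The nodes that a cube fixes. -/
def supp [Fintype V] (A : Cube V) : Finset V := Finset.univ.filter fun v => (A v).isSome

theorem mem_supp [Fintype V] {A : Cube V} {v : V} : v ∈ A.supp ↔ ∃ b, A v = some b := by
  simp [supp, Option.isSome_iff_exists]

theorem notMem_supp [Fintype V] {A : Cube V} {v : V} : v ∉ A.supp ↔ A v = none := by
  simp [supp]

theorem le_of_holds_of_supp_subset [Fintype V] {x : V → Bool} {A B : Cube V} (hA : Holds x A)
    (hB : Holds x B) (h : A.supp ⊆ B.supp) : A ≤ B := by
  intro v b hb
  obtain ⟨b', hb'⟩ := mem_supp.1 (h (mem_supp.2 ⟨b, hb⟩))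
  rw [hb', ← hA v b hb, ← hB v b' hb']

open scoped Classical in
/-- The cube that fixes in addition the node `c` to the value `b`. -/
def set (A : Cube V) (c : V) (b : Bool) : Cube V :=
  Function.update (β := fun _ => Option Bool) A c (some b)

open scoped Classical in
/-- The cube that no longer fixes the node `c`. -/
def unset (A : Cube V) (c : V) : Cube V := Function.update (β := fun _ => Option Bool) A c none

@[simp] theorem set_self (A : Cube V) (c : V) (b : Bool) : A.set c b c = some b := by
  classical exact Function.update_self ..

theorem set_of_ne (A : Cube V) {c v : V} (b : Bool) (h : v ≠ c) : A.set c b v = A v := by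
  classical exact Function.update_of_ne h ..

@[simp] theorem unset_self (A : Cube V) (c : V) : A.unset c c = none := by
  classical exact Function.update_self ..

theorem unset_of_ne (A : Cube V) {c v : V} (h : v ≠ c) : A.unset c v = A v := by
  classical exact Function.update_of_ne h ..

theorem set_unset {A : Cube V} {c : V} {b : Bool} (h : A c = some b) : (A.unset c).set c b = A := by
  funext v
  by_cases hv : v = c
  · subst hv; simp [h]
  · rw [set_of_ne _ _ hv, unset_of_ne _ hv]

theorem set_injOn (c : V) (b : Bool) :
    Set.InjOn (fun A : Cube V => A.set c b) {A | A c = none} := by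
  intro A hA B hB h
  funext v
  by_cases hv : v = c
  · subst hv; rw [hA, hB]
  · have := congrFun h v
    simpa only [set_of_ne _ _ hv] using this

theorem holds_set {x : V → Bool} {A : Cube V} {c : V} {b : Bool} (hA : A c = none) :
    Holds x (A.set c b) ↔ Holds x A ∧ x c = b := by
  constructor
  · intro h
    refine ⟨fun v d hd => h v d ?_, h c b (by simp)⟩
    rw [set_of_ne _ _ (by rintro rfl; simp [hA] at hd)]
    exact hd
  · rintro ⟨h, hc⟩ v d hd
    by_cases hv : v = c
    · subst hv
      simp only [set_self, Option.some.injEq] at hd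
      rw [hc, hd]
    · rw [set_of_ne _ _ hv] at hd
      exact h v d hd

theorem ind_set {x : V → Bool} {A : Cube V} {c : V} {b : Bool} (hA : A c = none) :
    ind x (A.set c b) = if x c = b then ind x A else 0 := by
  by_cases h : Holds x (A.set c b)
  · have h' := (holds_set hA).1 h
    rw [ind_of_holds h, if_pos h'.2, ind_of_holds h'.1]
  · rw [ind_of_not_holds h]
    split_ifs with hc
    · exact (ind_of_not_holds fun hx => h ((holds_set hA).2 ⟨hx, hc⟩)).symm
    · rfl

open scoped Classical in
theorem holds_update {x : V → Bool} {A : Cube V} {c : V} {b : Bool} (hA : A c = none) :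
    Holds (Function.update x c b) A ↔ Holds x A := by
  refine forall_congr' fun v => forall_congr' fun d => imp_congr_right fun hd => ?_
  rw [Function.update_of_ne (by rintro rfl; simp [hA] at hd)]

/-! ### Laminar families of cubes -/

section Laminar

variable [Fintype V]

/-- The family contains the full cube, no member fixes the node `c`, and the supports of any two
members are comparable. Any two members are then nested or disjoint as sets of assignments. -/
structure IsLaminar (P : Finset (Cube V)) (c : V) : Prop where
  bot_mem : ⊥ ∈ P
  apply_eq_none : ∀ A ∈ P, A c = none
  comparable : ∀ A ∈ P, ∀ B ∈ P, A.supp ⊆ B.supp ∨ B.supp ⊆ A.supp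

open scoped Classical in
/-- The children of a cube `A` in the family `P`: the largest members of `P` strictly inside `A`. -/
def children (P : Finset (Cube V)) (A : Cube V) : Finset (Cube V) :=
  P.filter fun B => A < B ∧ ∀ C ∈ P, A < C → C ≤ B → C = B

theorem mem_children {P : Finset (Cube V)} {A B : Cube V} :
    B ∈ children P A ↔ B ∈ P ∧ A < B ∧ ∀ C ∈ P, A < C → C ≤ B → C = B := by
  simp [children]

theorem children_subset (P : Finset (Cube V)) (A : Cube V) : children P A ⊆ P :=
  fun _ h => (mem_children.1 h).1

variable {P : Finset (Cube V)} {c : V}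

namespace IsLaminar

variable (hP : IsLaminar P c)
include hP

theorem le_or_le {x : V → Bool} {A B : Cube V} (hA : A ∈ P) (hB : B ∈ P) (hxA : Holds x A)
    (hxB : Holds x B) : A ≤ B ∨ B ≤ A :=
  (hP.comparable A hA B hB).imp (le_of_holds_of_supp_subset hxA hxB)
    (le_of_holds_of_supp_subset hxB hxA)

theorem exists_greatest (x : V → Bool) :
    ∃ A ∈ P, Holds x A ∧ ∀ B ∈ P, Holds x B → B ≤ A := by
  classical
  obtain ⟨A, hA⟩ := (P.filter (Holds x)).exists_maximal ⟨⊥, by simp [hP.bot_mem, holds_bot]⟩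
  have hA' := Finset.mem_filter.1 hA.1
  refine ⟨A, hA'.1, hA'.2, fun B hB hxB => ?_⟩
  rcases hP.le_or_le hA'.1 hB hA'.2 hxB with h | h
  · exact hA.2 (Finset.mem_filter.2 ⟨hB, hxB⟩) h
  · exact h

/-- The smallest member of the laminar family (as a set of assignments) that contains `x`. -/
def top (x : V → Bool) : Cube V := (hP.exists_greatest x).choose

theorem top_mem (x : V → Bool) : hP.top x ∈ P := (hP.exists_greatest x).choose_spec.1

theorem holds_top (x : V → Bool) : Holds x (hP.top x) := (hP.exists_greatest x).choose_spec.2.1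

theorem le_top {x : V → Bool} {B : Cube V} (hB : B ∈ P) (hxB : Holds x B) : B ≤ hP.top x :=
  (hP.exists_greatest x).choose_spec.2.2 B hB hxB

open scoped Classical in
theorem top_update (x : V → Bool) (b : Bool) : hP.top (Function.update x c b) = hP.top x := by
  have h1 := hP.top_mem x
  have h2 := hP.top_mem (Function.update x c b)
  refine le_antisymm (hP.le_top h2 ?_) (hP.le_top h1 ?_)
  · exact (holds_update (hP.apply_eq_none _ h2)).1 (hP.holds_top _)
  · exact (holds_update (hP.apply_eq_none _ h1)).2 (hP.holds_top _)

open scoped Classical in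
/-- A member of a laminar family is the disjoint union of its children and of the points for which
it is the smallest member. -/
theorem ind_eq (x : V → Bool) {A : Cube V} (hA : A ∈ P) :
    ind x A = (if hP.top x = A then 1 else 0) + ∑ B ∈ children P A, ind x B := by
  by_cases hxA : Holds x A
  swap
  · have h1 : hP.top x ≠ A := fun h => hxA (h ▸ hP.holds_top x)
    have h2 : ∀ B ∈ children P A, ind x B = 0 := fun B hB =>
      ind_of_not_holds fun h => hxA (h.mono (mem_children.1 hB).2.1.le)
    rw [ind_of_not_holds hxA, if_neg h1, Finset.sum_eq_zero h2, add_zero]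
  rw [ind_of_holds hxA]
  by_cases htop : hP.top x = A
  · have h2 : ∀ B ∈ children P A, ind x B = 0 := fun B hB => ind_of_not_holds fun h => by
      obtain ⟨hBP, hlt, -⟩ := mem_children.1 hB
      exact absurd (htop ▸ hP.le_top hBP h) hlt.not_ge
    rw [if_pos htop, Finset.sum_eq_zero h2, add_zero]
  · have hlt : A < hP.top x := lt_of_le_of_ne (hP.le_top hA hxA) (Ne.symm htop)
    obtain ⟨B, hB⟩ := (P.filter fun C => A < C ∧ C ≤ hP.top x).exists_minimal
      ⟨hP.top x, by simp [hP.top_mem, hlt]⟩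
    have hB' := Finset.mem_filter.1 hB.1
    have hxB : Holds x B := (hP.holds_top x).mono hB'.2.2
    have hBc : B ∈ children P A := mem_children.2 ⟨hB'.1, hB'.2.1, fun C hC hAC hCB =>
      le_antisymm hCB (hB.2 (Finset.mem_filter.2 ⟨hC, hAC, hCB.trans hB'.2.2⟩) hCB)⟩
    rw [if_neg htop, zero_add, Finset.sum_eq_single B, ind_of_holds hxB]
    · intro C hC hCB
      refine ind_of_not_holds fun hxC => hCB ?_
      obtain ⟨hCP, hAC, hCmin⟩ := mem_children.1 hC
      rcases hP.le_or_le hCP hB'.1 hxC hxB with h | h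
      · exact (mem_children.1 hBc).2.2 C hCP hAC h
      · exact (hCmin B hB'.1 hB'.2.1 h).symm
    · exact fun h => absurd hBc h

end IsLaminar

end Laminar

/-! ### Extending a distribution to one more node -/

section Mass

variable [Fintype V]

open scoped Classical in
/-- The mass that the weights `μ` on the assignments give to the cube `A`. -/
def mass (μ : (V → Bool) → ℝ) (A : Cube V) : ℝ := ∑ x, μ x * ind x A

open scoped Classical in
/-- `μ` is a probability distribution on the assignments. -/
def IsProb (μ : (V → Bool) → ℝ) : Prop := (∀ x, 0 ≤ μ x) ∧ ∑ x, μ x = 1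

theorem mass_bot {μ : (V → Bool) → ℝ} (hμ : IsProb μ) : mass μ ⊥ = 1 := by
  rw [mass, ← hμ.2]
  exact Finset.sum_congr rfl fun x _ => by rw [ind_of_holds (holds_bot x), mul_one]

theorem mass_eq_sum {μ : (V → Bool) → ℝ} {A : Cube V} {s : Finset (Cube V)}
    (h : ∀ x, ind x A = ∑ B ∈ s, ind x B) : mass μ A = ∑ B ∈ s, mass μ B := by
  simp only [mass, h, Finset.mul_sum]
  exact Finset.sum_comm

open scoped Classical in
/-- Resampling the coordinate `c`: the pairs `(x, d)` and `(update x c d, x c)` correspond. -/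
theorem sum_mul_sum_update (μ h : (V → Bool) → ℝ) (c : V) :
    ∑ x, (∑ d, μ (Function.update x c d)) * h x = ∑ x, μ x * ∑ b, h (Function.update x c b) := by
  simp only [Finset.sum_mul, Finset.mul_sum, ← Finset.sum_product']
  refine Finset.sum_nbij' (fun p => (Function.update p.1 c p.2, p.1 c))
    (fun p => (Function.update p.1 c p.2, p.1 c)) ?_ ?_ ?_ ?_ ?_ <;> simp

open scoped Classical in
/-- A distribution that matches `w` on a laminar family `P` can be changed in the coordinate `c`
only so as to match `w` also on all the cubes `A.set c b` with `A ∈ P`, provided `w` gives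
nonnegative mass to each difference of `A.set c b` and its children. The new value of `c` is drawn
with a probability that depends only on the smallest member of `P` that contains the point. -/
theorem exists_isProb_extend {P : Finset (Cube V)} {c : V} (hP : IsLaminar P c)
    {μ : (V → Bool) → ℝ} (hμ : IsProb μ) {w : Cube V → ℝ} (hmatch : ∀ A ∈ P, mass μ A = w A)
    (hsplit : ∀ A ∈ P, w A = w (A.set c false) + w (A.set c true))
    (hnonneg : ∀ A ∈ P, ∀ b, ∑ B ∈ children P A, w (B.set c b) ≤ w (A.set c b)) :
    ∃ μ' : (V → Bool) → ℝ, IsProb μ' ∧ (∀ A : Cube V, A c = none → mass μ' A = mass μ A) ∧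
      ∀ A ∈ P, ∀ b, mass μ' (A.set c b) = w (A.set c b) := by
  let m : Cube V → ℝ := fun A => ∑ x, μ x * (if hP.top x = A then 1 else 0)
  let t : Cube V → Bool → ℝ := fun A b => w (A.set c b) - ∑ B ∈ children P A, w (B.set c b)
  have ht : ∀ A ∈ P, ∀ b, 0 ≤ t A b := fun A hA b => sub_nonneg.2 (hnonneg A hA b)
  have hm : ∀ A ∈ P, m A = t A false + t A true := by
    intro A hA
    have h1 : mass μ A = m A + ∑ B ∈ children P A, mass μ B := by
      simp only [mass, m]
      rw [Finset.sum_comm, ← Finset.sum_add_distrib]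
      refine Finset.sum_congr rfl fun x _ => ?_
      rw [hP.ind_eq x hA, mul_add, Finset.mul_sum]
    have h2 : ∑ B ∈ children P A, mass μ B
        = ∑ B ∈ children P A, w (B.set c false) + ∑ B ∈ children P A, w (B.set c true) := by
      rw [← Finset.sum_add_distrib]
      refine Finset.sum_congr rfl fun B hB => ?_
      have hB' := children_subset P A hB
      rw [hmatch B hB', hsplit B hB']
    rw [hmatch A hA, hsplit A hA, h2] at h1
    simp only [t]
    linarith
  -- the conditional probability of the value `b`; its value on a null cell does not matter
  let q : Cube V → Bool → ℝ := fun A b =>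
    if m A = 0 then (if b then 1 else 0) else t A b / m A
  have hq0 : ∀ A ∈ P, ∀ b, 0 ≤ q A b := by
    intro A hA b
    have hmA : 0 ≤ m A := by rw [hm A hA]; exact add_nonneg (ht A hA _) (ht A hA _)
    simp only [q]
    split_ifs
    · exact zero_le_one
    · exact le_rfl
    · exact div_nonneg (ht A hA b) hmA
  have hq1 : ∀ A ∈ P, ∑ b, q A b = 1 := by
    intro A hA
    rw [Fintype.sum_bool]
    simp only [q]
    by_cases h : m A = 0
    · simp [h]
    · rw [if_neg h, if_neg h, ← add_div, add_comm, ← hm A hA, div_self h]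
  have hmq : ∀ A ∈ P, ∀ b, m A * q A b = t A b := by
    intro A hA b
    simp only [q]
    by_cases h : m A = 0
    · have h' := hm A hA
      rw [h] at h'
      have h0 := ht A hA false
      have h1 := ht A hA true
      rw [h, zero_mul]
      cases b <;> linarith
    · rw [if_neg h, mul_div_cancel₀ _ h]
  let μ' : (V → Bool) → ℝ := fun x => (∑ d, μ (Function.update x c d)) * q (hP.top x) (x c)
  have hsum : ∀ g : (V → Bool) → ℝ,
      ∑ x, μ' x * g x = ∑ x, μ x * ∑ b, q (hP.top x) b * g (Function.update x c b) := by
    intro g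
    have := sum_mul_sum_update μ (fun x => q (hP.top x) (x c) * g x) c
    simp only [hP.top_update, Function.update_self] at this
    rw [← this]
    exact Finset.sum_congr rfl fun x _ => mul_assoc _ _ _
  have hmass : ∀ A : Cube V, A c = none → mass μ' A = mass μ A := by
    intro A hA
    rw [mass, hsum, mass]
    refine Finset.sum_congr rfl fun x _ => ?_
    have : ∀ b, ind (Function.update x c b) A = ind x A := fun b => by
      simp only [ind, holds_update hA]
    simp only [this]
    rw [← Finset.sum_mul, hq1 _ (hP.top_mem x), one_mul]
  have hprob : IsProb μ' := by
    refine ⟨fun x => mul_nonneg (Finset.sum_nonneg fun d _ => hμ.1 _) (hq0 _ (hP.top_mem x) _), ?_⟩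
    have := hmass ⊥ rfl
    rw [mass_bot hμ] at this
    rw [← this, mass]
    exact Finset.sum_congr rfl fun x _ => by rw [ind_of_holds (holds_bot x), mul_one]
  have hset : ∀ A : Cube V, A c = none → ∀ b,
      mass μ' (A.set c b) = ∑ x, μ x * (q (hP.top x) b * ind x A) := by
    intro A hA b
    rw [mass, hsum]
    refine Finset.sum_congr rfl fun x _ => congrArg _ ?_
    rw [Finset.sum_eq_single b]
    · rw [ind_set hA, Function.update_self, if_pos rfl]
      simp only [ind, holds_update hA]
    · intro d _ hd
      rw [ind_set hA, Function.update_self, if_neg hd, mul_zero]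
    · simp
  refine ⟨μ', hprob, hmass, fun A hA b => ?_⟩
  induction A using WellFoundedGT.induction with
  | ind A ih =>
    have hc := hP.apply_eq_none A hA
    have h1 : mass μ' (A.set c b) = m A * q A b + ∑ B ∈ children P A, mass μ' (B.set c b) := by
      have h2 : ∑ B ∈ children P A, mass μ' (B.set c b)
          = ∑ B ∈ children P A, ∑ x, μ x * (q (hP.top x) b * ind x B) :=
        Finset.sum_congr rfl fun B hB => hset B (hP.apply_eq_none B (children_subset P A hB)) b
      rw [hset A hc b, h2, Finset.sum_comm, Finset.sum_mul, ← Finset.sum_add_distrib]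
      refine Finset.sum_congr rfl fun x _ => ?_
      rw [hP.ind_eq x hA, mul_add, mul_add, Finset.mul_sum, Finset.mul_sum]
      congr 1
      by_cases h : hP.top x = A
      · simp [h]
      · simp [h]
    have h3 : ∑ B ∈ children P A, mass μ' (B.set c b) = ∑ B ∈ children P A, w (B.set c b) :=
      Finset.sum_congr rfl fun B hB =>
        ih B (mem_children.1 hB).2.1 (children_subset P A hB)
    rw [h1, hmq A hA b, h3]
    simp [t]

end Mass

end Cube

/-! ### Systems of inequalities with coefficients 0, ±1 -/

/-- The inequality `∑ j ∈ pos, w j ≤ ∑ j ∈ neg, w j + rhs`. An index in both sets has the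
coefficient `0`. -/
structure UnitRow (J : Type*) where
  pos : Finset J
  neg : Finset J
  rhs : SignType

/-- The point `w` satisfies the inequality. -/
def UnitRow.Sat {J : Type*} (ρ : UnitRow J) (w : J → ℝ) : Prop :=
  ∑ j ∈ ρ.pos, w j ≤ ∑ j ∈ ρ.neg, w j + (ρ.rhs : ℝ)

theorem UnitRow.sat_zero {J : Type*} {s t : Finset J} {w : J → ℝ} :
    (UnitRow.mk s t 0).Sat w ↔ ∑ j ∈ s, w j ≤ ∑ j ∈ t, w j := by
  simp [UnitRow.Sat]

theorem SignType.coe_mem_unit (s : SignType) : (s : ℝ) ∈ ({-1, 0, 1} : Set ℝ) := by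
  cases s <;> simp

section Formulation

variable {I : Type*} [Fintype I]

theorem HasUnitExtendedFormulation.of_fintype {κ ρ : Type*} [Fintype κ] [Fintype ρ]
    (A : ρ → I → ℝ) (B : ρ → κ → ℝ) (b : ρ → ℝ)
    (hA : ∀ i j, A i j ∈ ({-1, 0, 1} : Set ℝ)) (hB : ∀ i j, B i j ∈ ({-1, 0, 1} : Set ℝ))
    (hb : ∀ i, b i ∈ ({-1, 0, 1} : Set ℝ)) {N : ℕ} (hκ : Fintype.card I + Fintype.card κ ≤ N)
    (hρ : Fintype.card ρ ≤ N) :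
    HasUnitExtendedFormulation
      {x : I → ℝ | ∃ y : κ → ℝ, ∀ r, ∑ i, A r i * x i + ∑ j, B r j * y j ≤ b r} N := by
  let f := (Fintype.equivFin ρ).symm
  let g := (Fintype.equivFin κ).symm
  refine ⟨Fintype.card κ, Fintype.card ρ, Matrix.of fun i j => A (f i) j,
    Matrix.of fun i j => B (f i) (g j), fun i => b (f i), fun _ _ => hA _ _, fun _ _ => hB _ _,
    fun _ => hb _, hκ, hρ, ?_⟩
  have key : ∀ (x : I → ℝ) (y : κ → ℝ),
      (Matrix.of (fun i j => A (f i) j)).mulVec x +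
        (Matrix.of fun i j => B (f i) (g j)).mulVec (y ∘ g) ≤ (fun i => b (f i)) ↔
      ∀ r, ∑ i, A r i * x i + ∑ j, B r j * y j ≤ b r := by
    intro x y
    rw [Pi.le_def, f.surjective.forall]
    refine forall_congr' fun i => ?_
    simp only [Pi.add_apply, Matrix.mulVec, dotProduct, Matrix.of_apply, Function.comp]
    rw [g.sum_comp (fun j => B (f i) j * y j)]
  ext x
  constructor
  · rintro ⟨y, hy⟩
    exact ⟨y ∘ g, (key x y).2 hy⟩
  · rintro ⟨y, hy⟩
    refine ⟨y ∘ g.symm, (key x _).1 ?_⟩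
    simpa [Function.comp_assoc] using hy

/-- The projection of the solution set of a system of unit rows to coordinates `φ i` has a unit
extended formulation. Only the variables in a set `T` that contains all those occurring in the rows
are counted, and the coordinates are copied by two inequalities each. -/
theorem HasUnitExtendedFormulation.of_rows {J : Type*} (L : Finset (UnitRow J)) (T : Finset J)
    (hT : ∀ ρ ∈ L, ρ.pos ⊆ T ∧ ρ.neg ⊆ T) (φ : I → J) {N : ℕ}
    (h1 : 2 * Fintype.card I + T.card ≤ N) (h2 : L.card + 2 * Fintype.card I ≤ N) :
    HasUnitExtendedFormulation
      {z : I → ℝ | ∃ w : J → ℝ, (∀ ρ ∈ L, ρ.Sat w) ∧ ∀ i, z i = w (φ i)} N := by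
  classical
  let T' := T ∪ Finset.univ.image φ
  have hφ : ∀ i, φ i ∈ T' := fun i =>
    Finset.mem_union_right _ (Finset.mem_image_of_mem _ (Finset.mem_univ i))
  let A : L ⊕ (I ⊕ I) → I → ℝ := Sum.elim (fun _ _ => 0)
    (Sum.elim (fun i i' => if i' = i then 1 else 0) (fun i i' => if i' = i then -1 else 0))
  let B : L ⊕ (I ⊕ I) → T' → ℝ := Sum.elim
    (fun ρ j => (if j.1 ∈ ρ.1.pos then 1 else 0) - (if j.1 ∈ ρ.1.neg then 1 else 0))
    (Sum.elim (fun i j => if j = ⟨φ i, hφ i⟩ then -1 else 0)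
      (fun i j => if j = ⟨φ i, hφ i⟩ then 1 else 0))
  let b : L ⊕ (I ⊕ I) → ℝ := Sum.elim (fun ρ => (ρ.1.rhs : ℝ)) (fun _ => 0)
  have hT' : T'.card ≤ T.card + Fintype.card I :=
    (Finset.card_union_le _ _).trans (Nat.add_le_add_left Finset.card_image_le _)
  have hform := HasUnitExtendedFormulation.of_fintype A B b
    (by
      rintro (ρ | i | i) j
      · simp [A]
      all_goals simp only [A, Sum.elim_inl, Sum.elim_inr]; split_ifs <;> simp)
    (by
      rintro (ρ | i | i) j
      all_goals simp only [B, Sum.elim_inl, Sum.elim_inr]; split_ifs <;> simp)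
    (by
      rintro (ρ | i)
      · exact SignType.coe_mem_unit _
      · simp [b])
    (N := N) (by rw [Fintype.card_coe]; omega)
    (by simp only [Fintype.card_sum, Fintype.card_coe]; omega)
  have hsum : ∀ (s : Finset J), s ⊆ T → ∀ w : J → ℝ,
      ∑ j : T', (if j.1 ∈ s then (1 : ℝ) else 0) * w j.1 = ∑ j ∈ s, w j := by
    intro s hs w
    rw [← Finset.sum_coe_sort s]
    simp only [ite_mul, one_mul, zero_mul]
    rw [Finset.sum_coe_sort T' (fun j => if j ∈ s then w j else 0), Finset.sum_coe_sort s w,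
      ← Finset.sum_filter]
    refine Finset.sum_congr ?_ fun _ _ => rfl
    ext j
    simp only [Finset.mem_filter, and_iff_right_iff_imp]
    exact fun hj => Finset.mem_union_left _ (hs hj)
  have key : ∀ (z : I → ℝ) (w : J → ℝ),
      (∀ r, ∑ i, A r i * z i + ∑ j : T', B r j * w j.1 ≤ b r) ↔
        (∀ ρ ∈ L, ρ.Sat w) ∧ ∀ i, z i = w (φ i) := by
    intro z w
    have hrow : ∀ ρ : L, (∑ i, A (Sum.inl ρ) i * z i + ∑ j : T', B (Sum.inl ρ) j * w j.1 ≤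
        b (Sum.inl ρ)) ↔ ρ.1.Sat w := by
      intro ρ
      simp only [A, B, b, Sum.elim_inl, zero_mul, Finset.sum_const_zero, zero_add, sub_mul,
        Finset.sum_sub_distrib]
      rw [hsum _ (hT _ ρ.2).1, hsum _ (hT _ ρ.2).2, UnitRow.Sat, sub_le_iff_le_add']
    rw [Sum.forall, Sum.forall]
    simp only [hrow]
    have hcopy : ∀ i, (∑ j : T', (if j = ⟨φ i, hφ i⟩ then (1 : ℝ) else 0) * w j.1) = w (φ i) := by
      intro i
      simp
    have hcopy' : ∀ i, (∑ j : T', (if j = ⟨φ i, hφ i⟩ then (-1 : ℝ) else 0) * w j.1)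
        = - w (φ i) := by
      intro i
      simp
    simp only [A, B, b, Sum.elim_inl, Sum.elim_inr, hcopy, hcopy']
    simp only [ite_mul, one_mul, zero_mul, neg_mul, Finset.sum_ite_eq', Finset.mem_univ, if_true,
      Subtype.forall]
    refine and_congr_right fun _ => ?_
    rw [← forall_and]
    refine forall_congr' fun i => ?_
    constructor
    · rintro ⟨h, h'⟩
      linarith
    · intro h
      constructor <;> linarith
  convert hform using 1
  ext z
  simp only [Set.mem_ofPred_eq]
  constructor
  · rintro ⟨w, hw⟩
    exact ⟨fun j => w j.1, (key z w).2 hw⟩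
  · rintro ⟨y, hy⟩
    let w : J → ℝ := fun j => if h : j ∈ T' then y ⟨j, h⟩ else 0
    have hw : ∀ j : T', w j.1 = y j := fun j => by simp [w]
    exact ⟨w, (key z w).1 (by simpa only [hw] using hy)⟩

end Formulation

namespace Cube

variable {V : Type*} [Fintype V]

/-! ### Cubes with a given support -/

open scoped Classical in
/-- The cubes with support `X` that agree with the cube `A₀` on the common part of their
supports. -/
def localCubes (A₀ : Cube V) (X : Finset V) : Finset (Cube V) :=
  Finset.univ.filter fun A => A.supp = X ∧ ∀ v b, A₀ v = some b → v ∈ X → A v = some b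

theorem mem_localCubes {A₀ A : Cube V} {X : Finset V} :
    A ∈ localCubes A₀ X ↔ A.supp = X ∧ ∀ v b, A₀ v = some b → v ∈ X → A v = some b := by
  simp [localCubes]

open scoped Classical in
theorem card_localCubes_le (A₀ : Cube V) (X : Finset V) :
    (localCubes A₀ X).card ≤ 2 ^ (X \ A₀.supp).card := by
  rw [← Finset.card_powerset]
  refine Finset.card_le_card_of_injOn (fun A => (X \ A₀.supp).filter fun v => A v = some true)
    (fun A _ => Finset.mem_powerset.2 (Finset.filter_subset _ _)) ?_
  intro A hA B hB h
  obtain ⟨hA1, hA2⟩ := mem_localCubes.1 hA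
  obtain ⟨hB1, hB2⟩ := mem_localCubes.1 hB
  funext v
  by_cases hv : v ∈ X
  · cases h0 : A₀ v with
    | some b => rw [hA2 v b h0 hv, hB2 v b h0 hv]
    | none =>
      have hmem : v ∈ X \ A₀.supp := Finset.mem_sdiff.2 ⟨hv, notMem_supp.2 h0⟩
      have hiff := Finset.ext_iff.1 h v
      simp only [Finset.mem_filter, hmem, true_and] at hiff
      obtain ⟨a, ha⟩ := mem_supp.1 (hA1 ▸ hv)
      obtain ⟨b, hb⟩ := mem_supp.1 (hB1 ▸ hv)
      rw [ha, hb] at hiff ⊢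
      cases a <;> cases b <;> simp_all
  · have hAv : A v = none := notMem_supp.1 (by rwa [hA1])
    have hBv : B v = none := notMem_supp.1 (by rwa [hB1])
    rw [hAv, hBv]

theorem self_mem_localCubes (A : Cube V) : A ∈ localCubes A A.supp :=
  mem_localCubes.2 ⟨rfl, fun _ _ h _ => h⟩

open scoped Classical in
theorem unset_mem_localCubes {A₀ A : Cube V} {X : Finset V} (h : A ∈ localCubes A₀ X) (c : V) :
    A.unset c ∈ localCubes A₀ (X.erase c) := by
  obtain ⟨h1, h2⟩ := mem_localCubes.1 h
  refine mem_localCubes.2 ⟨?_, fun v b hb hv => ?_⟩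
  · ext v
    by_cases hv : v = c
    · simp [hv, mem_supp]
    · rw [mem_supp, unset_of_ne _ hv, ← mem_supp, h1]
      simp [hv]
  · rw [Finset.mem_erase] at hv
    rw [unset_of_ne _ hv.1]
    exact h2 v b hb hv.2

open scoped Classical in
/-- A cube with the support `X ⊆ Y` is the disjoint union of the cubes inside it that have the
support `Y`. -/
theorem ind_eq_sum_localCubes {A₀ A : Cube V} {X Y : Finset V} (hA : A ∈ localCubes A₀ X)
    (hXY : X ⊆ Y) (hY : ∀ v ∈ A₀.supp, v ∈ Y → v ∈ X) (x : V → Bool) :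
    ind x A = ∑ B ∈ (localCubes A₀ Y).filter (A ≤ ·), ind x B := by
  obtain ⟨hA1, hA2⟩ := mem_localCubes.1 hA
  by_cases hx : Holds x A
  swap
  · rw [ind_of_not_holds hx, Finset.sum_eq_zero]
    exact fun B hB => ind_of_not_holds fun h => hx (h.mono (Finset.mem_filter.1 hB).2)
  let B₀ : Cube V := fun v => if v ∈ Y then some (x v) else none
  have hB₀x : Holds x B₀ := fun v b hb => by
    by_cases hv : v ∈ Y <;> simp_all [B₀]
  have hB₀s : B₀.supp = Y := by
    ext v
    have hv : B₀ v = if v ∈ Y then some (x v) else none := rfl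
    rw [mem_supp, hv]
    split_ifs with h <;> simp [h]
  have hAB : A ≤ B₀ := le_of_holds_of_supp_subset hx hB₀x (by rw [hA1, hB₀s]; exact hXY)
  have hB₀ : B₀ ∈ localCubes A₀ Y := mem_localCubes.2 ⟨hB₀s, fun v b hb hv =>
    hAB v b (hA2 v b hb (hY v (mem_supp.2 ⟨b, hb⟩) hv))⟩
  rw [ind_of_holds hx, Finset.sum_eq_single B₀, ind_of_holds hB₀x]
  · intro B hB hne
    refine ind_of_not_holds fun h => hne ?_
    have hBs := (mem_localCubes.1 (Finset.mem_filter.1 hB).1).1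
    exact le_antisymm (le_of_holds_of_supp_subset h hB₀x (by rw [hBs, hB₀s]))
      (le_of_holds_of_supp_subset hB₀x h (by rw [hBs, hB₀s]))
  · exact fun h => absurd (Finset.mem_filter.2 ⟨hB₀, hAB⟩) h

/-! ### The system of inequalities given by an elimination order -/

/-- The system `L` in variables indexed by the cubes describes the probabilities of the cubes in `F`
and of the values of the nodes in `U`: it is valid for every assignment, and the values that a
solution gives to these cubes come from a probability distribution. -/
structure Encodes (L : Finset (UnitRow (Cube V))) (F : Set (Cube V)) (U : Finset V) : Prop where
  sound : ∀ x, ∀ ρ ∈ L, ρ.Sat (ind x)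
  complete : ∀ w : Cube V → ℝ, (∀ ρ ∈ L, ρ.Sat w) → ∃ μ, IsProb μ ∧ w ⊥ = 1 ∧
    (∀ A ∈ F, mass μ A = w A) ∧
    ∀ u ∈ U, mass μ ((⊥ : Cube V).set u true) = w ((⊥ : Cube V).set u true)

variable {ι : Type*} [Fintype ι] (A₀ : ι → Cube V)

open scoped Classical in
/-- The cubes that arise in the elimination of `c` from the sets of the family through `c`. -/
def traceCubes (E : ι → Finset V) (c : V) : Finset (Cube V) :=
  insert ⊥ ((Finset.univ.filter fun s => c ∈ E s).biUnion fun s =>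
    localCubes (A₀ s) ((inflate E c s).erase c))

open scoped Classical in
/-- The equations that split each cube on a set of the family into cubes on the inflated set. -/
def inflateRows (E : ι → Finset V) (c : V) : Finset (UnitRow (Cube V)) :=
  Finset.univ.biUnion fun s => (localCubes (A₀ s) (E s)).biUnion fun A =>
    {⟨{A}, (localCubes (A₀ s) (inflate E c s)).filter (A ≤ ·), 0⟩,
      ⟨(localCubes (A₀ s) (inflate E c s)).filter (A ≤ ·), {A}, 0⟩}

open scoped Classical in
/-- The equations that split each cube of the laminar family `P` by the value of `c`, and the
inequalities that give nonnegative mass to what remains of each half outside the children. -/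
def splitRows (P : Finset (Cube V)) (c : V) : Finset (UnitRow (Cube V)) :=
  P.biUnion fun A =>
    {⟨{A}, {A.set c false, A.set c true}, 0⟩, ⟨{A.set c false, A.set c true}, {A}, 0⟩,
      ⟨(children P A).image fun B => B.set c false, {A.set c false}, 0⟩,
      ⟨(children P A).image fun B => B.set c true, {A.set c true}, 0⟩}

variable {A₀}

open scoped Classical in
theorem isLaminar_traceCubes (E : ι → Finset V) (c : V) : IsLaminar (traceCubes A₀ E c) c := by
  have hmem : ∀ A ∈ traceCubes A₀ E c,
      A.supp = ∅ ∨ ∃ s, c ∈ E s ∧ A.supp = (inflate E c s).erase c := by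
    intro A hA
    rcases Finset.mem_insert.1 hA with rfl | hA
    · left
      ext v
      simp [mem_supp]
    · simp only [Finset.mem_biUnion, Finset.mem_filter, Finset.mem_univ, true_and] at hA
      obtain ⟨s, hs, hA⟩ := hA
      exact Or.inr ⟨s, hs, (mem_localCubes.1 hA).1⟩
  refine ⟨Finset.mem_insert_self _ _, fun A hA => ?_, fun A hA B hB => ?_⟩
  · rw [← notMem_supp]
    rcases hmem A hA with h | ⟨s, -, h⟩ <;> simp [h]
  · rcases hmem A hA with h | ⟨s, hs, h⟩
    · left; simp [h]
    rcases hmem B hB with h' | ⟨t, ht, h'⟩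
    · right; simp [h']
    rw [h, h']
    exact (inflate_comparable hs ht).imp (Finset.erase_subset_erase c) (Finset.erase_subset_erase c)

theorem sat_splitRows_iff {P : Finset (Cube V)} {c : V} (hP : IsLaminar P c) (w : Cube V → ℝ) :
    (∀ ρ ∈ splitRows P c, ρ.Sat w) ↔ ∀ A ∈ P, w A = w (A.set c false) + w (A.set c true) ∧
      ∀ b, ∑ B ∈ children P A, w (B.set c b) ≤ w (A.set c b) := by
  classical
  have hne : ∀ A : Cube V, A.set c false ≠ A.set c true := fun A h => by
    have := congrFun h c
    simp at this
  have hsum : ∀ (A : Cube V) (b : Bool), ∑ B ∈ (children P A).image (fun B => B.set c b), w B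
      = ∑ B ∈ children P A, w (B.set c b) := fun A b =>
    Finset.sum_image ((set_injOn c b).mono fun B hB => hP.apply_eq_none B (children_subset P A hB))
  simp only [splitRows, Finset.mem_biUnion, Finset.mem_insert, Finset.mem_singleton,
    forall_exists_index, and_imp]
  rw [forall_comm]
  refine forall_congr' fun A => ?_
  rw [forall_comm]
  refine forall_congr' fun hA => ?_
  simp only [forall_eq_or_imp, forall_eq, UnitRow.sat_zero, Finset.sum_singleton,
    Finset.sum_pair (hne A), hsum, Bool.forall_bool]
  rw [← and_assoc, ← le_antisymm_iff]

theorem sat_splitRows_ind {P : Finset (Cube V)} {c : V} (hP : IsLaminar P c) (x : V → Bool) :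
    ∀ ρ ∈ splitRows P c, ρ.Sat (ind x) := by
  classical
  refine (sat_splitRows_iff hP _).2 fun A hA => ⟨?_, fun b => ?_⟩
  · rw [ind_set (hP.apply_eq_none A hA), ind_set (hP.apply_eq_none A hA)]
    cases x c <;> simp
  · rw [Finset.sum_congr rfl fun B hB =>
      ind_set (hP.apply_eq_none B (children_subset P A hB)), ind_set (hP.apply_eq_none A hA)]
    split_ifs
    · rw [hP.ind_eq x hA]
      split_ifs <;> simp
    · simp

open scoped Classical in
theorem sat_inflateRows_iff {E : ι → Finset V} {c : V} (w : Cube V → ℝ) :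
    (∀ ρ ∈ inflateRows A₀ E c, ρ.Sat w) ↔ ∀ s, ∀ A ∈ localCubes (A₀ s) (E s),
      w A = ∑ B ∈ (localCubes (A₀ s) (inflate E c s)).filter (A ≤ ·), w B := by
  simp only [inflateRows, Finset.mem_biUnion, Finset.mem_insert, Finset.mem_singleton,
    forall_exists_index, and_imp, Finset.mem_univ, true_and]
  rw [forall_comm]
  refine forall_congr' fun s => ?_
  rw [forall_comm]
  refine forall_congr' fun A => ?_
  rw [forall_comm]
  refine forall_congr' fun hA => ?_
  simp only [forall_eq_or_imp, forall_eq, UnitRow.sat_zero, Finset.sum_singleton]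
  rw [← le_antisymm_iff]

end Cube

namespace Cube

variable {V : Type*} [Fintype V]

open scoped Classical in
/-- The system for the empty set of nodes: it only says that the full cube has probability `1`. -/
def baseRows : Finset (UnitRow (Cube V)) := {⟨{⊥}, ∅, 1⟩, ⟨∅, {⊥}, -1⟩}

omit [Fintype V] in
theorem sat_baseRows_iff (w : Cube V → ℝ) : (∀ ρ ∈ baseRows, ρ.Sat w) ↔ w ⊥ = 1 := by
  classical
  simp only [baseRows, Finset.mem_insert, Finset.mem_singleton, forall_eq_or_imp, forall_eq,
    UnitRow.Sat, Finset.sum_singleton, Finset.sum_empty, SignType.coe_one, SignType.coe_neg_one]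
  rw [le_antisymm_iff]
  constructor <;> rintro ⟨h, h'⟩ <;> constructor <;> linarith

theorem encodes_baseRows {F : Set (Cube V)} (hF : ∀ A ∈ F, A = ⊥) :
    Encodes baseRows F (∅ : Finset V) := by
  classical
  refine ⟨fun x => (sat_baseRows_iff _).2 (ind_of_holds (holds_bot x)), fun w hw => ?_⟩
  have hw' := (sat_baseRows_iff w).1 hw
  -- any distribution will do, such as a point mass
  have hμ : IsProb (fun x : V → Bool => if x = fun _ => true then (1 : ℝ) else 0) := by
    refine ⟨fun x => ?_, by simp⟩
    dsimp only
    split_ifs <;> norm_num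
  refine ⟨_, hμ, hw', fun A hA => ?_, by simp⟩
  rw [hF A hA, mass_bot hμ, hw']

variable {ι : Type*} [Fintype ι] {A₀ : ι → Cube V}

/-- The cubes on the sets of a family. -/
def familyCubes (A₀ : ι → Cube V) (E : ι → Finset V) : Set (Cube V) :=
  {A | ∃ s, A ∈ localCubes (A₀ s) (E s)}

open scoped Classical in
/-- Elimination of the node `c`: a system for the family that is inflated at `c` and deprived of `c`
extends to a system for the original family. -/
theorem Encodes.step {E : ι → Finset V} {c : V} {U : Finset V} (hEU : ∀ s, E s ⊆ U)
    (hE : ∀ s, ∀ v ∈ (A₀ s).supp, v ∈ U → v ∈ E s) {L : Finset (UnitRow (Cube V))}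
    (hL : Encodes L (familyCubes A₀ fun s => (inflate E c s).erase c) (U.erase c)) :
    Encodes (L ∪ inflateRows A₀ E c ∪ splitRows (traceCubes A₀ E c) c) (familyCubes A₀ E) U := by
  have hP := isLaminar_traceCubes (A₀ := A₀) E c
  have hind : ∀ s, ∀ A ∈ localCubes (A₀ s) (E s), ∀ x, ind x A =
      ∑ B ∈ (localCubes (A₀ s) (inflate E c s)).filter (A ≤ ·), ind x B := fun s A hA x =>
    ind_eq_sum_localCubes hA (subset_inflate s)
      (fun v hv hvY => hE s v hv (inflate_subset hEU s hvY)) x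
  refine ⟨fun x ρ hρ => ?_, fun w hw => ?_⟩
  · rcases Finset.mem_union.1 hρ with hρ | hρ
    · rcases Finset.mem_union.1 hρ with hρ | hρ
      · exact hL.sound x ρ hρ
      · exact (sat_inflateRows_iff _).2 (fun s A hA => hind s A hA x) ρ hρ
    · exact sat_splitRows_ind hP x ρ hρ
  · obtain ⟨μ, hμ, hbot, hF, hU⟩ := hL.complete w fun ρ hρ =>
      hw ρ (Finset.mem_union_left _ (Finset.mem_union_left _ hρ))
    have hinf := (sat_inflateRows_iff w).1 fun ρ hρ =>
      hw ρ (Finset.mem_union_left _ (Finset.mem_union_right _ hρ))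
    have hsplit := (sat_splitRows_iff hP w).1 fun ρ hρ => hw ρ (Finset.mem_union_right _ hρ)
    have hmatch : ∀ A ∈ traceCubes A₀ E c, mass μ A = w A := by
      intro A hA
      rcases Finset.mem_insert.1 hA with rfl | hA
      · rw [mass_bot hμ, hbot]
      · simp only [Finset.mem_biUnion, Finset.mem_filter, Finset.mem_univ, true_and] at hA
        obtain ⟨s, -, hA⟩ := hA
        exact hF A ⟨s, hA⟩
    obtain ⟨μ', hμ', hold, hnew⟩ := exists_isProb_extend hP hμ hmatch (fun A hA => (hsplit A hA).1)
      (fun A hA => (hsplit A hA).2)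
    refine ⟨μ', hμ', hbot, ?_, fun u hu => ?_⟩
    · rintro A ⟨s, hA⟩
      rw [hinf s A hA, mass_eq_sum (hind s A hA)]
      refine Finset.sum_congr rfl fun B hB => ?_
      replace hB := (Finset.mem_filter.1 hB).1
      have hBs := (mem_localCubes.1 hB).1
      have hBu := unset_mem_localCubes hB c
      by_cases hc : c ∈ E s
      · obtain ⟨b, hb⟩ := mem_supp.1 (hBs ▸ mem_inflate_self.2 hc)
        have hBP : B.unset c ∈ traceCubes A₀ E c := Finset.mem_insert_of_mem
          (Finset.mem_biUnion.2 ⟨s, Finset.mem_filter.2 ⟨Finset.mem_univ s, hc⟩, hBu⟩)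
        have := hnew _ hBP b
        rwa [set_unset hb] at this
      · have hcB : c ∉ inflate E c s := fun h => hc (mem_inflate_self.1 h)
        rw [hold B (notMem_supp.1 (hBs ▸ hcB))]
        rw [← Finset.erase_eq_of_notMem hcB] at hB
        exact hF B ⟨s, hB⟩
    · by_cases huc : u = c
      · rw [huc]
        exact hnew ⊥ hP.bot_mem true
      · rw [hold _ (set_of_ne _ _ (Ne.symm huc))]
        exact hU u (Finset.mem_erase.2 ⟨huc, hu⟩)

open scoped Classical in
/-- The variables that occur in the rows added by the elimination of `c`. -/
def stepVars (A₀ : ι → Cube V) (E : ι → Finset V) (c : V) : Finset (Cube V) :=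
  (Finset.univ.biUnion fun s => localCubes (A₀ s) (E s)) ∪
    (Finset.univ.biUnion fun s => localCubes (A₀ s) (inflate E c s)) ∪
    (traceCubes A₀ E c ∪ (traceCubes A₀ E c).image (fun A => A.set c false) ∪
      (traceCubes A₀ E c).image (fun A => A.set c true))

open scoped Classical in
theorem subset_stepVars {E : ι → Finset V} {c : V} {ρ : UnitRow (Cube V)}
    (hρ : ρ ∈ inflateRows A₀ E c ∪ splitRows (traceCubes A₀ E c) c) :
    ρ.pos ⊆ stepVars A₀ E c ∧ ρ.neg ⊆ stepVars A₀ E c := by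
  have h1 : ∀ s, localCubes (A₀ s) (E s) ⊆ stepVars A₀ E c := fun s A hA =>
    Finset.mem_union_left _ (Finset.mem_union_left _
      (Finset.mem_biUnion.2 ⟨s, Finset.mem_univ s, hA⟩))
  have h2 : ∀ s, localCubes (A₀ s) (inflate E c s) ⊆ stepVars A₀ E c := fun s A hA =>
    Finset.mem_union_left _ (Finset.mem_union_right _
      (Finset.mem_biUnion.2 ⟨s, Finset.mem_univ s, hA⟩))
  have h3 : traceCubes A₀ E c ⊆ stepVars A₀ E c := fun A hA =>
    Finset.mem_union_right _ (Finset.mem_union_left _ (Finset.mem_union_left _ hA))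
  have h4 : ∀ A ∈ traceCubes A₀ E c, ∀ b, A.set c b ∈ stepVars A₀ E c := by
    intro A hA b
    cases b
    · exact Finset.mem_union_right _ (Finset.mem_union_left _ (Finset.mem_union_right _
        (Finset.mem_image.2 ⟨A, hA, rfl⟩)))
    · exact Finset.mem_union_right _ (Finset.mem_union_right _ (Finset.mem_image.2 ⟨A, hA, rfl⟩))
  have h5 : ∀ A b, (children (traceCubes A₀ E c) A).image (fun B => B.set c b) ⊆ stepVars A₀ E c :=
    fun A b => Finset.image_subset_iff.2 fun B hB => h4 B (children_subset _ _ hB) b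
  rcases Finset.mem_union.1 hρ with hρ | hρ
  · simp only [inflateRows, Finset.mem_biUnion, Finset.mem_univ, true_and, Finset.mem_insert,
      Finset.mem_singleton] at hρ
    obtain ⟨s, A, hA, rfl | rfl⟩ := hρ
    · exact ⟨Finset.singleton_subset_iff.2 (h1 s hA), (Finset.filter_subset _ _).trans (h2 s)⟩
    · exact ⟨(Finset.filter_subset _ _).trans (h2 s), Finset.singleton_subset_iff.2 (h1 s hA)⟩
  · simp only [splitRows, Finset.mem_biUnion, Finset.mem_insert, Finset.mem_singleton] at hρ
    obtain ⟨A, hA, rfl | rfl | rfl | rfl⟩ := hρ <;>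
      simp [Finset.insert_subset_iff, h3 hA, h4 A hA, h5]

open scoped Classical in
theorem card_step_le [Nonempty ι] {E : ι → Finset V} {c : V} {K : ℕ}
    (h1 : ∀ s, (localCubes (A₀ s) (E s)).card ≤ K)
    (h2 : ∀ s, (localCubes (A₀ s) (inflate E c s)).card ≤ K)
    (h3 : ∀ s, (localCubes (A₀ s) ((inflate E c s).erase c)).card ≤ K) (hK : 1 ≤ K) :
    (inflateRows A₀ E c ∪ splitRows (traceCubes A₀ E c) c).card ≤ 10 * (Fintype.card ι * K) ∧
      (stepVars A₀ E c).card ≤ 10 * (Fintype.card ι * K) := by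
  have hpos : 1 ≤ Fintype.card ι * K := Nat.mul_pos Fintype.card_pos hK
  have hsum : ∀ (G : ι → Finset V), (∀ s, (localCubes (A₀ s) (G s)).card ≤ K) →
      (Finset.univ.biUnion fun s => localCubes (A₀ s) (G s)).card ≤ Fintype.card ι * K :=
    fun G hG => Finset.card_biUnion_le_card_mul _ _ _ fun s _ => hG s
  have htrace : (traceCubes A₀ E c).card ≤ 2 * (Fintype.card ι * K) := by
    have : (traceCubes A₀ E c).card ≤ Fintype.card ι * K + 1 := by
      refine (Finset.card_insert_le _ _).trans (Nat.add_le_add_right ?_ 1)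
      exact (Finset.card_le_card (Finset.biUnion_subset_biUnion_of_subset_left _
        (Finset.filter_subset _ _))).trans (hsum _ h3)
    omega
  have hinf : (inflateRows A₀ E c).card ≤ 2 * (Fintype.card ι * K) := by
    have : (inflateRows A₀ E c).card ≤ Fintype.card ι * (K * 2) :=
      Finset.card_biUnion_le_card_mul _ _ _ fun s _ =>
        (Finset.card_biUnion_le_card_mul _ _ 2 fun A _ => Finset.card_le_two).trans
          (Nat.mul_le_mul_right _ (h1 s))
    calc _ ≤ _ := this
      _ = _ := by ring
  have hsplit : (splitRows (traceCubes A₀ E c) c).card ≤ (traceCubes A₀ E c).card * 4 :=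
    Finset.card_biUnion_le_card_mul _ _ _ fun A _ => Finset.card_le_four
  constructor
  · have := Finset.card_union_le (inflateRows A₀ E c) (splitRows (traceCubes A₀ E c) c)
    omega
  · have e1 := Finset.card_union_le
      ((Finset.univ.biUnion fun s => localCubes (A₀ s) (E s)) ∪
        (Finset.univ.biUnion fun s => localCubes (A₀ s) (inflate E c s)))
      (traceCubes A₀ E c ∪ (traceCubes A₀ E c).image (fun A => A.set c false) ∪
        (traceCubes A₀ E c).image (fun A => A.set c true))
    have e2 := Finset.card_union_le (Finset.univ.biUnion fun s => localCubes (A₀ s) (E s))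
      (Finset.univ.biUnion fun s => localCubes (A₀ s) (inflate E c s))
    have e3 := Finset.card_union_le
      (traceCubes A₀ E c ∪ (traceCubes A₀ E c).image (fun A => A.set c false))
      ((traceCubes A₀ E c).image (fun A => A.set c true))
    have e4 := Finset.card_union_le (traceCubes A₀ E c)
      ((traceCubes A₀ E c).image (fun A => A.set c false))
    have e5 := Finset.card_image_le (s := traceCubes A₀ E c) (f := fun A => A.set c false)
    have e6 := Finset.card_image_le (s := traceCubes A₀ E c) (f := fun A => A.set c true)
    have e7 := hsum _ h1
    have e8 := hsum _ h2
    rw [stepVars]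
    omega

open scoped Classical in
/-- Elimination of all nodes. If the β-cycles of a family are monochromatic with respect to labels
`lab s` that are node sets containing the members, and `lab s` has at most `k` nodes outside the
support of the given cube `A₀ s`, then there is a system of `O(2 ^ k)` rows and variables for
each node and each member. -/
theorem exists_encodes [Nonempty ι] {lab : ι → Finset V} {k : ℕ}
    (hk : ∀ s, (lab s \ (A₀ s).supp).card ≤ k) :
    ∀ (n : ℕ) (U : Finset V) (E : ι → Finset V), U.card = n → (∀ s, E s ⊆ U) →
      (∀ s, E s ⊆ lab s) → (∀ s, ∀ v ∈ (A₀ s).supp, v ∈ U → v ∈ E s) → CyclesMono E lab →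
      ∃ (L : Finset (UnitRow (Cube V))) (T : Finset (Cube V)),
        L.card ≤ 2 + n * (10 * (Fintype.card ι * 2 ^ k)) ∧
        T.card ≤ 2 + n * (10 * (Fintype.card ι * 2 ^ k)) ∧
        (∀ ρ ∈ L, ρ.pos ⊆ T ∧ ρ.neg ⊆ T) ∧ Encodes L (familyCubes A₀ E) U := by
  intro n
  induction n with
  | zero =>
    intro U E hU hEU _ _ _
    rw [Finset.card_eq_zero] at hU
    subst hU
    refine ⟨baseRows, {⊥}, ?_, by simp, ?_, encodes_baseRows ?_⟩
    · rw [zero_mul]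
      exact Finset.card_le_two
    · simp [baseRows]
    · rintro A ⟨s, hA⟩
      funext v
      refine notMem_supp.1 fun hv => ?_
      rw [(mem_localCubes.1 hA).1] at hv
      exact absurd (hEU s hv) (by simp)
  | succ n ih =>
    intro U E hU hEU hElab hE hmono
    obtain ⟨c, hcU, hcomp⟩ := exists_node_comparable hmono (Finset.card_pos.1 (by omega)) hEU
    have hinflab : ∀ s, inflate E c s ⊆ lab s := by
      intro s x hx
      obtain ⟨t, ht, hxt⟩ := exists_lab_eq_of_mem_inflate hcomp hx
      exact ht ▸ hElab t hxt
    obtain ⟨L, T, hLcard, hTcard, hLT, hL⟩ := ih (U.erase c) (fun s => (inflate E c s).erase c)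
      (by rw [Finset.card_erase_of_mem hcU, hU]; rfl)
      (fun s => Finset.erase_subset_erase c (inflate_subset hEU s))
      (fun s => (Finset.erase_subset _ _).trans (hinflab s))
      (fun s v hv hvU => by
        rw [Finset.mem_erase] at hvU ⊢
        exact ⟨hvU.1, subset_inflate s (hE s v hv hvU.2)⟩)
      (hmono.inflate_erase hcomp)
    have hcard : ∀ (X : ι → Finset V), (∀ s, X s ⊆ lab s) →
        ∀ s, (localCubes (A₀ s) (X s)).card ≤ 2 ^ k := fun X hX s =>
      (card_localCubes_le _ _).trans (Nat.pow_le_pow_right (by norm_num)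
        ((Finset.card_le_card (Finset.sdiff_subset_sdiff (hX s) le_rfl)).trans (hk s)))
    obtain ⟨hrows, hvars⟩ := card_step_le (A₀ := A₀) (hcard E hElab) (hcard _ hinflab)
      (hcard _ fun s => (Finset.erase_subset c _).trans (hinflab s)) Nat.one_le_two_pow
    have hstep := hL.step hEU hE
    rw [Finset.union_assoc] at hstep
    refine ⟨_, T ∪ stepVars A₀ E c, ?_, ?_, fun ρ hρ => ?_, hstep⟩
    · refine (Finset.card_union_le _ _).trans ?_
      rw [Nat.succ_mul]
      omega
    · refine (Finset.card_union_le _ _).trans ?_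
      rw [Nat.succ_mul]
      omega
    · rcases Finset.mem_union.1 hρ with hρ | hρ
      · exact ⟨(hLT ρ hρ).1.trans Finset.subset_union_left,
          (hLT ρ hρ).2.trans Finset.subset_union_left⟩
      · exact ⟨(subset_stepVars hρ).1.trans Finset.subset_union_right,
          (subset_stepVars hρ).2.trans Finset.subset_union_right⟩

end Cube

/-! ### Labelling the edges by the components of the union of the β-cycles -/

namespace Hypergraph

variable {V : Type*}

/-- The nodes that are joined to a node of `e` in `G`. -/
def reach (G : Hypergraph V) (e : Set V) : Set V :=
  {w | ∃ u ∈ e, Relation.ReflTransGen G.Adj u w}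

theorem reflTransGen_adj_symm {G : Hypergraph V} {u w : V}
    (h : Relation.ReflTransGen G.Adj u w) : Relation.ReflTransGen G.Adj w u := by
  induction h with
  | refl => exact .refl
  | tail _ h ih => exact .head h.symm ih

theorem subset_reach (G : Hypergraph V) (e : Set V) : e ⊆ G.reach e := fun u hu => ⟨u, hu, .refl⟩

theorem reach_subset_of_edges_meet {G : Hypergraph V} {e f : Set V} (he : e ∈ E(G)) {x : V}
    (hxe : x ∈ e) (hxf : x ∈ f) : G.reach e ⊆ G.reach f := by
  rintro w ⟨u, hu, huw⟩
  exact ⟨x, hxf, .head ⟨e, he, hxe, hu⟩ huw⟩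

theorem reach_eq_of_edges_meet {G : Hypergraph V} {e f : Set V} (he : e ∈ E(G)) (hf : f ∈ E(G))
    {x : V} (hxe : x ∈ e) (hxf : x ∈ f) : G.reach e = G.reach f :=
  (reach_subset_of_edges_meet he hxe hxf).antisymm (reach_subset_of_edges_meet hf hxf hxe)

/-- The partial hypergraph induced on the nodes that are joined to a node of `e`. -/
def componentOf (G : Hypergraph V) (e : Set V) : Hypergraph V where
  vertexSet := V(G) ∩ G.reach e
  edgeSet := {f | f ∈ E(G) ∧ f ⊆ G.reach e}
  subset_vertexSet_of_mem_edgeSet' := fun _ hf => Set.subset_inter hf.1.subset_vertexSet hf.2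

theorem reflTransGen_componentOf {G : Hypergraph V} {e : Set V} {u w : V}
    (hu : u ∈ G.reach e) (h : Relation.ReflTransGen G.Adj u w) :
    Relation.ReflTransGen (G.componentOf e).Adj u w := by
  induction h with
  | refl => exact .refl
  | tail hub hbc ih =>
    obtain ⟨f, hf, hbf, hcf⟩ := hbc
    refine .tail ih ⟨f, ⟨hf, ?_⟩, hbf, hcf⟩
    obtain ⟨a, ha, hau⟩ := hu
    exact fun y hy => ⟨a, ha, (hau.trans hub).tail ⟨f, hf, hbf, hy⟩⟩

theorem componentOf_isComponent {G : Hypergraph V} {e : Set V} (he : e ∈ E(G))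
    (hne : e.Nonempty) : (G.componentOf e).IsComponent G := by
  have hmem : e ∈ E(G.componentOf e) := ⟨he, G.subset_reach e⟩
  refine ⟨⟨⟨Set.inter_subset_left, fun f hf => hf.1⟩, ?_⟩, ?_⟩
  · rintro u ⟨-, hu⟩ w ⟨-, hw⟩
    obtain ⟨a, ha, hau⟩ := id hu
    obtain ⟨b, hb, hbw⟩ := hw
    exact reflTransGen_componentOf hu
      ((reflTransGen_adj_symm hau).trans (.head ⟨e, he, ha, hb⟩ hbw))
  · intro K hK hconn hle
    obtain ⟨a, ha⟩ := hne
    have haK : a ∈ V(K) := hle.1 ((G.componentOf e).mem_vertexSet_of_mem_edgeSet hmem ha)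
    have hadj : K.Adj ≤ G.Adj := fun x y ⟨f, hf, h⟩ => ⟨f, hK.2 hf, h⟩
    have hV : V(K) ⊆ G.reach e := fun w hw =>
      ⟨a, ha, Relation.ReflTransGen.mono hadj a w (hconn a haK w hw)⟩
    refine Hypergraph.ext (Set.Subset.antisymm (Set.subset_inter hK.1 hV) hle.1)
      (Set.Subset.antisymm (fun f hf => ⟨hK.2 hf, hf.subset_vertexSet.trans hV⟩) hle.2)

theorem reach_subset_sUnion {G : Hypergraph V} {e : Set V} (he : e ∈ E(G)) :
    G.reach e ⊆ ⋃₀ E(G.componentOf e) := by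
  rintro w ⟨u, hu, huw⟩
  rcases (Relation.ReflTransGen.cases_tail_iff _ _ _).1 huw with rfl | ⟨b, hub, f, hf, hbf, hwf⟩
  · exact ⟨e, ⟨he, G.subset_reach e⟩, hu⟩
  · exact ⟨f, ⟨hf, fun y hy => ⟨u, hu, hub.tail ⟨f, hf, hbf, hy⟩⟩⟩, hwf⟩

theorem ncard_sub_ncard_le_gap [Finite V] {E' : Set (Set V)} {e : Set V} (he : e ∈ E') :
    (⋃₀ E').ncard - e.ncard ≤ gap E' := by
  refine le_csSup ⟨Nat.card V, ?_⟩ ⟨e, he, rfl⟩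
  rintro _ ⟨f, -, rfl⟩
  exact (Nat.sub_le _ _).trans (Set.ncard_le_card _)

/-- A β-cycle of an indexed family of edges of `G` runs within the union of all β-cycles. -/
theorem mem_betaUnion_of_isCyc {G : Hypergraph V} {ι : Type*} {E : ι → Finset V}
    (hE : ∀ s, (E s : Set V) ∈ E(G)) {q : ℕ} {v : ℕ → V} {e : ℕ → ι} (h : IsCyc E q v e) {i : ℕ}
    (hi : i < q) : (E (e i) : Set V) ∈ E(G.betaUnion) := by
  have h3 := h.three_le
  let C : G.BetaCycle :=
    { length := q
      three_le := h3
      node := fun i => v i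
      edge := fun i => (E (e i) : Set V)
      node_injective := by
        intro a b hab
        have h1 := (h.mem_iff a a.2 a a.2).2 (Or.inl rfl)
        have h2 := (h.mem_iff b b.2 b b.2).2 (Or.inl rfl)
        have hab' : v a = v b := hab
        rw [hab'] at h1
        rw [← hab'] at h2
        have h1' := (h.mem_iff b b.2 a a.2).1 h1
        have h2' := (h.mem_iff a a.2 b b.2).1 h2
        exact Fin.ext (by omega)
      edge_injective := by
        intro a b hab
        have hab' : E (e a) = E (e b) := Finset.coe_injective hab
        have h1 := (h.mem_iff a a.2 a a.2).2 (Or.inl rfl)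
        have h2 := (h.mem_iff b b.2 b b.2).2 (Or.inl rfl)
        rw [hab'] at h1
        rw [← hab'] at h2
        have h1' := (h.mem_iff a a.2 b b.2).1 h1
        have h2' := (h.mem_iff b b.2 a a.2).1 h2
        exact Fin.ext (by omega)
      edge_mem := fun i => hE _
      node_mem_edge_iff := by
        intro a b
        refine (h.mem_iff a a.2 b b.2).trans ?_
        obtain ⟨n, rfl⟩ : ∃ n, q = n + 1 := ⟨q - 1, by omega⟩
        have ha := a.2
        have hb := b.2
        rw [Fin.ext_iff, Fin.ext_iff, coe_finRotate]
        split_ifs with hbn <;> rw [Fin.ext_iff, Fin.val_last] at hbn <;> omega }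
  exact Set.mem_iUnion.2 ⟨C, ⟨i, hi⟩, rfl⟩

end Hypergraph

namespace SignedHypergraph

variable {V : Type*} [Fintype V] (H : SignedHypergraph V)

/-- The node sets of the signed edges. -/
def nodeFamily (s : {s : SignedEdge V // s ∈ H.edges}) : Finset V := s.1.nodes

open scoped Classical in
/-- The label of an edge: the node set of its component in the union of the β-cycles, or its own
node set if it lies on no β-cycle. -/
def label (s : {s : SignedEdge V // s ∈ H.edges}) : Finset V :=
  if (s.1.nodes : Set V) ∈ E(H.underlying.betaUnion) then
    (H.underlying.betaUnion.reach s.1.nodes).toFinset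
  else s.1.nodes

variable {H}

theorem coe_label_of_mem {s : {s : SignedEdge V // s ∈ H.edges}}
    (h : (s.1.nodes : Set V) ∈ E(H.underlying.betaUnion)) :
    (H.label s : Set V) = H.underlying.betaUnion.reach s.1.nodes := by
  simp [label, h]

theorem nodeFamily_subset_label (s : {s : SignedEdge V // s ∈ H.edges}) :
    H.nodeFamily s ⊆ H.label s := by
  by_cases h : (s.1.nodes : Set V) ∈ E(H.underlying.betaUnion)
  · rw [← Finset.coe_subset, coe_label_of_mem h]
    exact Hypergraph.subset_reach _ _
  · rw [label, if_neg h]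
    exact le_rfl

theorem cyclesMono_label : CyclesMono H.nodeFamily H.label := by
  intro q v e h
  have h3 := h.three_le
  have hmem : ∀ i < q, ((e i).1.nodes : Set V) ∈ E(H.underlying.betaUnion) := fun i hi =>
    Hypergraph.mem_betaUnion_of_isCyc (G := H.underlying) (E := H.nodeFamily)
      (fun s => ⟨s.1, s.2, rfl⟩) h hi
  have key : ∀ i < q, H.label (e i) = H.label (e 0) := by
    intro i
    induction i with
    | zero => exact fun _ => rfl
    | succ i ih =>
      intro hi
      rw [← ih (by omega), ← Finset.coe_inj, coe_label_of_mem (hmem _ hi),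
        coe_label_of_mem (hmem i (by omega))]
      exact Hypergraph.reach_eq_of_edges_meet (hmem _ hi) (hmem i (by omega))
        ((h.mem_iff (i + 1) hi (i + 1) hi).2 (by omega))
        ((h.mem_iff (i + 1) hi i (by omega)).2 (by omega))
  intro i hi j hj
  rw [key i hi, key j hj]

open scoped Classical in
theorem card_label_sdiff_le {k : ℕ}
    (hk : ∀ K : Hypergraph V, K.IsComponent H.underlying.betaUnion → Hypergraph.gap E(K) ≤ k)
    (s : {s : SignedEdge V // s ∈ H.edges}) : (H.label s \ s.1.nodes).card ≤ k := by
  by_cases h : (s.1.nodes : Set V) ∈ E(H.underlying.betaUnion)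
  · have hne : (s.1.nodes : Set V).Nonempty := by
      rw [Finset.coe_nonempty, ← Finset.card_pos]
      have := s.1.two_le_card
      omega
    have hgap := hk _ (Hypergraph.componentOf_isComponent h hne)
    have hle := Hypergraph.ncard_sub_ncard_le_gap
      (E' := E(H.underlying.betaUnion.componentOf s.1.nodes)) (e := s.1.nodes)
      ⟨h, Hypergraph.subset_reach _ _⟩
    have hlab : (H.label s).card
        ≤ (⋃₀ E(H.underlying.betaUnion.componentOf s.1.nodes)).ncard := by
      rw [← Set.ncard_coe_finset, coe_label_of_mem h]
      exact Set.ncard_le_ncard (Hypergraph.reach_subset_sUnion h) (Set.toFinite _)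
    rw [Set.ncard_coe_finset] at hle
    have hcard := Finset.card_sdiff_of_subset (nodeFamily_subset_label s)
    rw [nodeFamily] at hcard
    omega
  · simp [label, h]

/-! ### The formulation of the pseudo-Boolean polytope -/

open scoped Classical in
/-- The cube of the assignments that satisfy all literals of a signed edge. -/
def _root_.SignedEdge.cube (s : SignedEdge V) : Cube V :=
  fun v => if h : v ∈ s.nodes then some (decide (s.sign ⟨v, h⟩ = 1)) else none

open scoped Classical in
theorem _root_.SignedEdge.supp_cube (s : SignedEdge V) : s.cube.supp = s.nodes := by
  ext v
  have hv : s.cube v = if h : v ∈ s.nodes then some (decide (s.sign ⟨v, h⟩ = 1)) else none := rfl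
  rw [Cube.mem_supp, hv]
  split_ifs with h <;> simp [h]

variable (H) in
/-- The cube whose indicator is a coordinate of the points of the pseudo-Boolean set. -/
def coordCube : H.Coord → Cube V :=
  Sum.elim (fun v => (⊥ : Cube V).set v true) (fun s => s.1.cube)

omit [Fintype V] in
theorem ind_node (x : V → Bool) (v : V) :
    Cube.ind x ((⊥ : Cube V).set v true) = if x v = true then 1 else 0 := by
  rw [Cube.ind_set rfl, Cube.ind_of_holds (Cube.holds_bot x)]

theorem literal_ite (ε : ℤˣ) (b : Bool) :
    literal ε (if b = true then 1 else 0) = if b = decide (ε = 1) then 1 else 0 := by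
  by_cases h : ε = 1 <;> cases b <;> simp [literal, h]

omit [Fintype V] in
theorem ind_cube (x : V → Bool) (s : SignedEdge V) :
    Cube.ind x s.cube = ∏ v : s.nodes, literal (s.sign v) (if x v = true then 1 else 0) := by
  classical
  simp only [literal_ite, Finset.prod_ite_zero, Finset.prod_const_one]
  have : Cube.Holds x s.cube ↔
      ∀ v ∈ (Finset.univ : Finset s.nodes), x v = decide (s.sign v = 1) := by
    constructor
    · intro h v _
      exact h v _ (by rw [SignedEdge.cube, dif_pos v.2])
    · intro h v b hb
      rw [SignedEdge.cube] at hb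
      split_ifs at hb with hv
      rw [h ⟨v, hv⟩ (Finset.mem_univ _)]
      exact Option.some.inj hb
  by_cases h : Cube.Holds x s.cube
  · rw [Cube.ind_of_holds h, if_pos (this.1 h)]
  · rw [Cube.ind_of_not_holds h, if_neg fun h' => h (this.2 h')]

omit [Fintype V] in
theorem PBS_eq_range :
    H.PBS = Set.range fun (x : V → Bool) (i : H.Coord) => Cube.ind x (H.coordCube i) := by
  classical
  ext z
  constructor
  · rintro ⟨h01, hz⟩
    have hnode : ∀ v, (if decide (z (Sum.inl v) = 1) = true then (1 : ℝ) else 0)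
        = z (Sum.inl v) := by
      intro v
      rcases h01 (Sum.inl v) with h | h <;> simp [h]
    refine ⟨fun v => decide (z (Sum.inl v) = 1), ?_⟩
    funext i
    rcases i with v | s
    · exact (ind_node _ v).trans (hnode v)
    · refine (ind_cube _ s.1).trans ?_
      simp only [hnode]
      exact (hz s).symm
  · rintro ⟨x, rfl⟩
    refine ⟨fun i => ?_, fun s => ?_⟩
    · by_cases h : Cube.Holds x (H.coordCube i)
      · exact Or.inr (Cube.ind_of_holds h)
      · exact Or.inl (Cube.ind_of_not_holds h)
    · refine (ind_cube x s.1).trans (Finset.prod_congr rfl fun v _ => ?_)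
      exact congrArg _ (ind_node x v.1).symm

theorem PBP_eq_of_encodes {L : Finset (UnitRow (Cube V))} {F : Set (Cube V)}
    (hL : Cube.Encodes L F Finset.univ) (hF : ∀ s ∈ H.edges, s.cube ∈ F) :
    H.PBP = {z | ∃ w : Cube V → ℝ, (∀ ρ ∈ L, ρ.Sat w) ∧ ∀ i, z i = w (H.coordCube i)} := by
  classical
  rw [PBP, PBS_eq_range]
  refine Set.Subset.antisymm (convexHull_min ?_ ?_) ?_
  · rintro _ ⟨x, rfl⟩
    exact ⟨Cube.ind x, hL.sound x, fun i => rfl⟩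
  · rintro z ⟨w, hw, hz⟩ z' ⟨w', hw', hz'⟩ a b ha hb hab
    refine ⟨fun A => a * w A + b * w' A, fun ρ hρ => ?_, fun i => ?_⟩
    · have h1 := mul_le_mul_of_nonneg_left (hw ρ hρ) ha
      have h2 := mul_le_mul_of_nonneg_left (hw' ρ hρ) hb
      simp only [UnitRow.Sat, Finset.sum_add_distrib, ← Finset.mul_sum]
      have h3 : (ρ.rhs : ℝ) = a * ρ.rhs + b * ρ.rhs := by rw [← add_mul, hab, one_mul]
      rw [h3]
      linarith
    · simp [hz, hz']
  · rintro z ⟨w, hw, hz⟩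
    obtain ⟨μ, hμ, -, hmatch, hnode⟩ := hL.complete w hw
    have hz' : z = ∑ x, μ x • fun i : H.Coord => Cube.ind x (H.coordCube i) := by
      funext i
      rw [hz i, Finset.sum_apply]
      change _ = Cube.mass μ (H.coordCube i)
      rcases i with v | s
      · exact (hnode v (Finset.mem_univ v)).symm
      · exact (hmatch _ (hF s.1 s.2)).symm
    rw [hz']
    exact (convex_convexHull ℝ _).sum_mem (fun x _ => hμ.1 x) hμ.2
      fun x _ => subset_convexHull ℝ _ ⟨x, rfl⟩

theorem one_le_rank (hS : H.edges.Nonempty) : 1 ≤ H.rank := by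
  obtain ⟨s, hs⟩ := hS
  have : (s.nodes : Set V).ncard ≤ H.rank := by
    refine le_csSup ⟨Nat.card V, ?_⟩ ⟨_, ⟨s, hs, rfl⟩, rfl⟩
    rintro _ ⟨f, -, rfl⟩
    exact Set.ncard_le_card _
  rw [Set.ncard_coe_finset] at this
  have := s.two_le_card
  omega

theorem rank_le_card (H : SignedHypergraph V) : H.rank ≤ Fintype.card V := by
  refine csSup_le' ?_
  rintro _ ⟨f, -, rfl⟩
  rw [← Nat.card_eq_fintype_card]
  exact Set.ncard_le_card _

theorem hasUnitExtendedFormulation_PBP (hS : H.edges.Nonempty) {k : ℕ}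
    (hk : ∀ K : Hypergraph V, K.IsComponent H.underlying.betaUnion → Hypergraph.gap E(K) ≤ k) :
    HasUnitExtendedFormulation H.PBP
      (16 * (H.rank * 2 ^ k * Fintype.card V * H.edges.card)) := by
  classical
  have : Nonempty {s : SignedEdge V // s ∈ H.edges} := hS.to_subtype
  obtain ⟨L, T, hLcard, hTcard, hLT, hL⟩ := Cube.exists_encodes (k := k) (lab := H.label)
    (A₀ := fun s : {s : SignedEdge V // s ∈ H.edges} => s.1.cube)
    (fun s => by rw [SignedEdge.supp_cube]; exact card_label_sdiff_le hk s)
    (Fintype.card V) Finset.univ H.nodeFamily rfl (fun s => Finset.subset_univ _)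
    nodeFamily_subset_label (fun s v hv _ => by rwa [SignedEdge.supp_cube] at hv) cyclesMono_label
  rw [PBP_eq_of_encodes hL fun s hs =>
    ⟨⟨s, hs⟩, by rw [nodeFamily, ← SignedEdge.supp_cube]; exact Cube.self_mem_localCubes _⟩]
  rw [Fintype.card_coe] at hLcard hTcard
  have hI : Fintype.card H.Coord = Fintype.card V + H.edges.card := by
    rw [Fintype.card_sum, Fintype.card_coe]
  have hS1 : 1 ≤ H.edges.card := hS.card_pos
  have hV1 : 1 ≤ Fintype.card V := by
    obtain ⟨s, hs⟩ := hS
    exact Nat.one_le_iff_ne_zero.2 fun h => by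
      have h1 := s.two_le_card
      have h2 := Finset.card_le_univ s.nodes
      omega
  have hr := one_le_rank hS
  have hK : 1 ≤ 2 ^ k := Nat.one_le_two_pow
  set n := Fintype.card V
  set m := H.edges.card
  set K := 2 ^ k
  have h1 : n * (m * K) ≤ H.rank * K * n * m := by
    calc n * (m * K) = 1 * (K * n * m) := by ring
      _ ≤ H.rank * (K * n * m) := Nat.mul_le_mul_right _ hr
      _ = _ := by ring
  have h2 : n * m ≤ n * (m * K) := Nat.mul_le_mul_left _ (Nat.le_mul_of_pos_right _ hK)
  -- `n + m ≤ n * m + 1 ≤ 2 * n * m` bounds the number of coordinates, which count twice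
  have h3 : n + m ≤ n * m + 1 := by nlinarith
  have h4 : 1 ≤ n * m := Nat.mul_pos hV1 hS1
  have h5 : n * (10 * (m * K)) = 10 * (n * (m * K)) := by ring
  rw [h5] at hLcard hTcard
  exact HasUnitExtendedFormulation.of_rows L T hLT _ (by rw [hI]; omega) (by rw [hI]; omega)

end SignedHypergraph

theorem HasUnitExtendedFormulation.mono {I : Type*} [Fintype I] {P : Set (I → ℝ)} {N N' : ℕ}
    (h : HasUnitExtendedFormulation P N) (hN : N ≤ N') : HasUnitExtendedFormulation P N' := by
  obtain ⟨n, m, A, B, b, hA, hB, hb, hn, hm, hP⟩ := h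
  exact ⟨n, m, A, B, b, hA, hB, hb, hn.trans hN, hm.trans hN, hP⟩

/-- If `k` is at most a constant times the logarithm of `P`, then `2 ^ k` is at most a power of
`P`, up to the case `P = 0`. -/
theorem two_pow_le_of_le_mul_log {a : ℝ} {k P : ℕ} (h : (k : ℝ) ≤ a * Real.log P) :
    2 ^ k ≤ P ^ ⌈|a|⌉₊ + 1 := by
  rcases Nat.eq_zero_or_pos P with rfl | hP
  · have hk : k = 0 := by
      -- `Real.log 0 = 0`
      have : (k : ℝ) ≤ 0 := by simpa using h
      exact_mod_cast this.antisymm (Nat.cast_nonneg k)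
    simp [hk]
  · have hP1 : (1 : ℝ) ≤ P := by exact_mod_cast hP
    have hlog : 0 ≤ Real.log P := Real.log_nonneg hP1
    have hk : (k : ℝ) ≤ ⌈|a|⌉₊ * Real.log P :=
      h.trans (mul_le_mul_of_nonneg_right ((le_abs_self a).trans (Nat.le_ceil _)) hlog)
    have hexp : (2 : ℝ) ^ k ≤ (P : ℝ) ^ ⌈|a|⌉₊ := by
      calc (2 : ℝ) ^ k ≤ Real.exp 1 ^ k := by
            gcongr
            have := Real.add_one_le_exp (1 : ℝ)
            linarith
        _ = Real.exp k := by rw [← Real.exp_nat_mul, mul_one]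
        _ ≤ Real.exp (⌈|a|⌉₊ * Real.log P) := Real.exp_le_exp.2 hk
        _ = (P : ℝ) ^ ⌈|a|⌉₊ := by rw [Real.exp_nat_mul, Real.exp_log (by linarith)]
    have : 2 ^ k ≤ P ^ ⌈|a|⌉₊ := by exact_mod_cast hexp
    omega

end

theorem mainTheorem9 :
    -- an absolute constant `C` with the bound `C r 2^k |V| |S|`
    (∃ C : ℕ, ∀ (V : Type*) [Fintype V] (H : SignedHypergraph V) (k : ℕ),
      H.edges.Nonempty →
      (∀ K : Hypergraph V, K.IsComponent H.underlying.betaUnion → Hypergraph.gap E(K) ≤ k) →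
      HasUnitExtendedFormulation H.PBP
        (C * (H.rank * 2 ^ k * Fintype.card V * H.edges.card))) ∧
    -- polynomial size when `k = O(log poly(|V|, |S|))`
    (∀ (a : ℝ) (p : MvPolynomial (Fin 2) ℕ), ∃ q : MvPolynomial (Fin 2) ℕ,
      ∀ (V : Type*) [Fintype V] (H : SignedHypergraph V) (k : ℕ),
        H.edges.Nonempty →
        (∀ K : Hypergraph V, K.IsComponent H.underlying.betaUnion → Hypergraph.gap E(K) ≤ k) →
        (k : ℝ) ≤ a * Real.log (MvPolynomial.eval ![Fintype.card V, H.edges.card] p : ℕ) →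
        HasUnitExtendedFormulation H.PBP
          (MvPolynomial.eval ![Fintype.card V, H.edges.card] q)) := by
  refine ⟨⟨16, fun V _ H k hS hk => SignedHypergraph.hasUnitExtendedFormulation_PBP hS hk⟩,
    fun a p => ⟨16 * (MvPolynomial.X 0 * (p ^ ⌈|a|⌉₊ + 1) * MvPolynomial.X 0 * MvPolynomial.X 1),
      fun V _ H k hS hk hlog => ?_⟩⟩
  refine (SignedHypergraph.hasUnitExtendedFormulation_PBP hS hk).mono ?_
  simp only [map_mul, map_add, map_pow, map_one, map_ofNat, MvPolynomial.eval_X,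
    Matrix.cons_val_zero, Matrix.cons_val_one]
  have h1 := two_pow_le_of_le_mul_log hlog
  have h2 := H.rank_le_card
  gcongr
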